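/- **Theorem (Strichartz estimates).** Let $\psi\in C^\infty(\mathbb{R},[0,1])$ be an even function with $\operatorname{supp}\psi\subset[-2,2]$ and $\psi\equiv1$ on $[-1,1]$, and let $\varphi(x)=\psi(x)-\psi(2x)$. For $k\in\mathbb{Z}$ let $P_k$ be the Littlewood–Paley projection on $\mathbb{R}^2$, $\widehat{P_kf}(\xi)=\varphi(2^{-k}|\xi|)\hat f(\xi)$, where $\hat f(\xi)=\int_{\mathbb{R}^2}e^{-ix\cdot\xi}f(x)\,dx$. For $\kappa>0$ let $\Lambda_\kappa(\xi)=\kappa\,\xi_1/|\xi|$, and for $t\in\mathbb{R}$ let $e^{it\Lambda_\kappa}$ be the Fourier multiplier operator on $\mathbb{R}^2$ with symbol $e^{it\Lambda_\kappa(\xi)}$. For functions $F(t,x)$ of $(t,x)\in\mathbb{R}\times\mathbb{R}^2$ both operators act in $x$. Norms $L^q_tL^r_x$ are taken over $\mathbb{R}\times\mathbb{R}^2$. A pair $(q,r)$ is called $\frac12$-admissible if $$\frac1q+\frac1{2r}=\frac14,\qquad 4\le q\le\infty,\quad 2\le r\le\infty,$$ with $1/\infty=0$; primes denote conjugate exponents,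 $\frac1q+\frac1{q'}=\frac1r+\frac1{r'}=1$. The following hold. 1. For every $\frac12$-admissible pair $(q,r)$ there is a constant $C$, depending only on $q$ and $\psi$, such that for all $\kappa>0$, $k\in\mathbb{Z}$ and $f\in\mathcal{S}(\mathbb{R}^2;\mathbb{C})$ $$\|e^{it\Lambda_\kappa}P_kf\|_{L^q_tL^r_x}\le C\,\kappa^{-\frac1q}\,2^{\frac{4k}{q}}\,\|P_kf\|_{L^2}.$$ 2. For every $\frac12$-admissible pair $(q,r)$ there is a constant $C$, depending only on $q$ and $\psi$, such that for all $\kappa>0$, $k\in\mathbb{Z}$ and $F\in\mathcal{S}(\mathbb{R}\times\mathbb{R}^2;\mathbb{C})$ $$\Big\|\int_{\mathbb{R}}e^{-is\Lambda_\kappa}P_kF(s,x)\,ds\Big\|_{L^2_x}\le C\,\kappa^{-\frac1q}\,2^{\frac{4k}{q}}\,\|P_kF\|_{L^{q'}_tL^{r'}_x}.$$ 3. For all $\frac12$-admissible pairs $(q_1,r_1)$ and $(q_2,r_2)$ there is a constant $C$, depending only on $q_1,q_2$ and $\psi$, such that for all $\kappa>0$, $k\in\mathbb{Z}$ and $F\in\mathcal{S}(\mathbb{R}\times\mathbb{R}^2;\mathbb{C})$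 $$\Big\|\int_0^te^{i(t-s)\Lambda_\kappa}P_kF(s,x)\,ds\Big\|_{L^{q_1}_tL^{r_1}_x}\le C\,\kappa^{-\frac1{q_1}-\frac1{q_2}}\,2^{\frac{4k}{q_1}+\frac{4k}{q_2}}\,\|P_kF\|_{L^{q_2'}_tL^{r_2'}_x}.$$ -/

import Mathlib

open MeasureTheory
open scoped ENNReal NNReal FourierTransform SchwartzMap ContDiff

noncomputable section

namespace StrichartzSobolev

/-- The plane `ℝ²` with its Euclidean norm. -/
abbrev Plane : Type := EuclideanSpace ℝ (Fin 2)

/-- The dispersion relation `Λ_κ(ξ) = κ ξ₁ / |ξ|`. (Its value at the single point `ξ = 0`, here `0`,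
is irrelevant: symbols matter only up to null sets.) -/
def dispersion (κ : ℝ) (ξ : Plane) : ℝ := κ * (ξ 0 / ‖ξ‖)

/-- The Fourier multiplier operator `m(D)`, i.e. `(m(D) f)^(ξ) = m(ξ) f^(ξ)`, where
`f^(ξ) = ∫ e^{-i x·ξ} f(x) dx`. Mathlib's `𝓕 f (η) = ∫ e^{-2πi x·η} f(x) dx` is `f^(2πη)`, hence the
symbol is evaluated at `ξ = 2πη`. -/
def fourierMult (m : Plane → ℂ) (f : Plane → ℂ) : Plane → ℂ :=
  𝓕⁻ (fun η : Plane => m ((2 * Real.pi) • η) * 𝓕 f η)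

/-- The group `e^{itΛ_κ}`, the Fourier multiplier with symbol `e^{itΛ_κ(ξ)}`. -/
def propagator (κ t : ℝ) (f : Plane → ℂ) : Plane → ℂ :=
  fourierMult (fun ξ => Complex.exp (Complex.I * (t * dispersion κ ξ : ℝ))) f

/-- `ψ ∈ C^∞(ℝ, [0,1])` is an even bump function with `supp ψ ⊆ [-2,2]` and `ψ = 1` on `[-1,1]`. -/
structure IsBump (ψ : ℝ → ℝ) : Prop where
  smooth : ContDiff ℝ ∞ ψ
  mem_Icc : ∀ x, ψ x ∈ Set.Icc (0 : ℝ) 1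
  even : ∀ x, ψ (-x) = ψ x
  tsupport_subset : tsupport ψ ⊆ Set.Icc (-2) 2
  eq_one : ∀ x ∈ Set.Icc (-1 : ℝ) 1, ψ x = 1

/-- The dyadic cutoff `φ(x) = ψ(x) - ψ(2x)`. -/
def dyadicCutoff (ψ : ℝ → ℝ) (x : ℝ) : ℝ := ψ x - ψ (2 * x)

/-- The Littlewood-Paley projection `P_k`, with symbol `φ(2^{-k}|ξ|)`. -/
def lpProj (ψ : ℝ → ℝ) (k : ℤ) (f : Plane → ℂ) : Plane → ℂ :=
  fourierMult (fun ξ => (dyadicCutoff ψ ((2 : ℝ) ^ (-k) * ‖ξ‖) : ℂ)) f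

/-- `P_k` acting in the space variable on a function `F(t,x)` of time and space. -/
def lpProjSpace (ψ : ℝ → ℝ) (k : ℤ) (F : ℝ × Plane → ℂ) (t : ℝ) : Plane → ℂ :=
  lpProj ψ k (fun x => F (t, x))

/-- The mixed norm `‖G‖_{L^q_t L^r_x}` over `ℝ × ℝ²`, with values in `[0,∞]`. -/
def mixedNorm (q r : ℝ≥0∞) (G : ℝ → Plane → ℂ) : ℝ≥0∞ :=
  eLpNorm (fun t : ℝ => eLpNorm (G t) r (volume : Measure Plane)) q (volume : Measure ℝ)

/-- `(q,r)` is `½`-admissible: `1/q + 1/(2r) = 1/4`, `4 ≤ q ≤ ∞`, `2 ≤ r ≤ ∞`, where `1/∞ = 0`. -/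
structure HalfAdmissible (q r : ℝ≥0∞) : Prop where
  four_le : 4 ≤ q
  two_le : 2 ≤ r
  scaling : 1 / q + 1 / (2 * r) = 1 / 4

/-- The factor `κ^{-a} 2^{4ka}`; the estimates use it with `a = 1/q` or `a = 1/q₁ + 1/q₂`. -/
def strichartzFactor (κ : ℝ) (k : ℤ) (a : ℝ) : ℝ≥0∞ :=
  ENNReal.ofReal (κ ^ (-a) * (2 : ℝ) ^ (4 * (k : ℝ) * a))

end StrichartzSobolev

end

/-! The symbol is homogeneous of degree 0, so on the circle |ξ| = ρ the phase x·ξ + tΛ_κ(ξ) equals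
(ρx + κt e₁)·ω, linear in the unit vector ω. The kernel of the group on a dyadic annulus is thus an
integral over ρ of the Fourier transform of the circle, evaluated along the line ρ ↦ ρx + κt e₁.
That transform decays like |z|^{-1/2} by van der Corput, and integrating in ρ absorbs the
singularity where the line comes close to the origin. Hence the kernel is O(2^{2k}|κt|^{-1/2})
uniformly in x (`enorm_setIntegral_annulus_wave_le`).

The rest is an abstract `TT*` argument. Every admissible pair lies between (∞,2) and (4,∞), and the
passage between these ends is elementary: |g|^r ≤ (sup|g|)^{r-2}|g|². The L^∞L² end is Plancherel.
For the L⁴L^∞ end, the supremum in x is replaced by evaluation along a measurable curve X(t) and the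
L⁴ norm in time is dualised. The squared L² norm of the resulting wave packet is a double integral
of h(s) and the conjugate of h(t) against the kernel at (s - t, X(s) - X(t)), which
Hardy–Littlewood–Sobolev for |t-s|^{-1/2} bounds (`lintegral_lintegral_rieszKernel_le`,
`eLpNorm_packet_le`).

The dual estimate follows by pairing the frequency profile with its own free evolution. In the
retarded estimate the cutoff to s between 0 and t is a bounded weight σ(t,s). Since the kernel
enters only through its absolute value, such a weight costs nothing and no Christ–Kiselev argument
is needed (`enorm_integral_mul_evol_profile_le`).

With D = 12·2^k κ^{-1/4}, each pair contributes D^{4/q} = 12^{4/q} κ^{-1/q} 2^{4k/q}. -/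

namespace StrichartzSobolev

/-! ### Hardy–Littlewood–Sobolev on the line. -/

/-- The Riesz kernel `|u|^{-1/2}` on the line. -/
noncomputable def rieszKernel (u : ℝ) : ℝ≥0∞ := ENNReal.ofReal |u| ^ (-(1 / 2) : ℝ)

lemma measurable_rieszKernel : Measurable rieszKernel := by
  unfold rieszKernel; fun_prop

lemma rieszKernel_sub_comm (s t : ℝ) : rieszKernel (s - t) = rieszKernel (t - s) := by
  unfold rieszKernel; rw [abs_sub_comm]

lemma lintegral_comp_abs (f : ℝ → ℝ≥0∞) :
    ∫⁻ u, f |u| = 2 * ∫⁻ u in Set.Ioi (0 : ℝ), f u := by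
  have h1 : ∫⁻ u in Set.Ioi (0 : ℝ), f |u| = ∫⁻ u in Set.Ioi (0 : ℝ), f u :=
    setLIntegral_congr_fun measurableSet_Ioi fun u hu => by simp only [abs_of_pos (Set.mem_Ioi.1 hu)]
  have h2 : ∫⁻ u in Set.Iio (0 : ℝ), f |u| = ∫⁻ u in Set.Ioi (0 : ℝ), f |u| := by
    have := (Measure.measurePreserving_neg (volume : Measure ℝ)).setLIntegral_comp_preimage_emb
      (MeasurableEquiv.neg ℝ).measurableEmbedding (fun u => f |u|) (Set.Ioi 0)
    rw [← this]
    simp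
  rw [← lintegral_add_compl _ (measurableSet_Ioi (a := (0 : ℝ))), Set.compl_Ioi,
    setLIntegral_congr Iio_ae_eq_Iic.symm, h2, h1, two_mul]

lemma setLIntegral_rieszKernel_near {δ : ℝ} (hδ : 0 < δ) :
    ∫⁻ u in {u : ℝ | |u| < δ}, rieszKernel u = 4 * ENNReal.ofReal δ ^ (1 / 2 : ℝ) := by
  have hm : MeasurableSet {u : ℝ | |u| < δ} := measurableSet_lt (by fun_prop) measurable_const
  rw [← lintegral_indicator hm]
  have h := lintegral_comp_abs ((Set.Iio δ).indicator fun u => ENNReal.ofReal u ^ (-(1 / 2) : ℝ))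
  have e : (fun u : ℝ => ((Set.Iio δ).indicator fun u => ENNReal.ofReal u ^ (-(1 / 2) : ℝ)) |u|) =
      {u : ℝ | |u| < δ}.indicator rieszKernel := by
    ext u
    simp [Set.indicator_apply, rieszKernel]
  rw [e] at h
  rw [h, setLIntegral_indicator measurableSet_Iio]
  have hset : Set.Iio δ ∩ Set.Ioi 0 = Set.Ioo 0 δ := by ext; simp [and_comm]
  have hi : IntegrableOn (fun u : ℝ => u ^ (-(1 / 2) : ℝ)) (Set.Ioc 0 δ) := by
    have := intervalIntegral.intervalIntegrable_rpow' (a := 0) (b := δ) (r := (-(1 / 2) : ℝ))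
      (by norm_num)
    rwa [intervalIntegrable_iff_integrableOn_Ioc_of_le hδ.le] at this
  rw [hset, setLIntegral_congr Ioo_ae_eq_Ioc]
  have : ∫⁻ u in Set.Ioc 0 δ, ENNReal.ofReal u ^ (-(1 / 2) : ℝ) =
      ∫⁻ u in Set.Ioc 0 δ, ENNReal.ofReal (u ^ (-(1 / 2) : ℝ)) :=
    setLIntegral_congr_fun measurableSet_Ioc fun u hu => by
      simp only [ENNReal.ofReal_rpow_of_pos hu.1]
  rw [this, ← ofReal_integral_eq_lintegral_ofReal hi, ← intervalIntegral.integral_of_le hδ.le,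
    integral_rpow (by left; norm_num), ENNReal.ofReal_rpow_of_pos hδ]
  · rw [Real.zero_rpow (by norm_num)]
    rw [show (4 : ℝ≥0∞) = ENNReal.ofReal 4 by simp, show (2 : ℝ≥0∞) = ENNReal.ofReal 2 by simp,
      ← ENNReal.ofReal_mul (by norm_num), ← ENNReal.ofReal_mul (by norm_num)]
    congr 1
    norm_num
    ring
  · exact (ae_restrict_iff' measurableSet_Ioc).2 (ae_of_all _ fun u hu => by
      have := hu.1; simp only [Pi.zero_apply]; positivity)

/-- The fourth power is |u|^{-2}, integrable at infinity; 4 is the exponent dual to 4/3, as needed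
for Hölder on the far region. -/
lemma setLIntegral_rieszKernel_far {δ : ℝ} (hδ : 0 < δ) :
    ∫⁻ u in {u : ℝ | |u| < δ}ᶜ, rieszKernel u ^ (4 : ℝ) = 2 * (ENNReal.ofReal δ)⁻¹ := by
  have hm : MeasurableSet {u : ℝ | |u| < δ} := measurableSet_lt (by fun_prop) measurable_const
  rw [← lintegral_indicator hm.compl]
  have h := lintegral_comp_abs ((Set.Ici δ).indicator fun u => ENNReal.ofReal u ^ (-2 : ℝ))
  have e : (fun u : ℝ => ((Set.Ici δ).indicator fun u => ENNReal.ofReal u ^ (-2 : ℝ)) |u|) =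
      {u : ℝ | |u| < δ}ᶜ.indicator fun u => rieszKernel u ^ (4 : ℝ) := by
    ext u
    simp only [Set.indicator_apply, rieszKernel, Set.mem_Ici, Set.mem_compl_iff, Set.mem_ofPred_eq,
      not_lt, ← ENNReal.rpow_mul]
    norm_num
  rw [e] at h
  rw [h, setLIntegral_indicator measurableSet_Ici]
  have hset : Set.Ici δ ∩ Set.Ioi 0 = Set.Ici δ := by
    ext x; simp only [Set.mem_inter_iff, Set.mem_Ici, Set.mem_Ioi]; constructor
    · exact And.left
    · intro h; exact ⟨h, hδ.trans_le h⟩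
  rw [hset, setLIntegral_congr Ioi_ae_eq_Ici.symm]
  have : ∫⁻ u in Set.Ioi δ, ENNReal.ofReal u ^ (-2 : ℝ) =
      ∫⁻ u in Set.Ioi δ, ENNReal.ofReal (u ^ (-2 : ℝ)) :=
    setLIntegral_congr_fun measurableSet_Ioi fun u hu => by
      simp only [ENNReal.ofReal_rpow_of_pos (hδ.trans (Set.mem_Ioi.1 hu))]
  rw [this, ← ofReal_integral_eq_lintegral_ofReal (integrableOn_Ioi_rpow_of_lt (by norm_num) hδ),
    integral_Ioi_rpow_of_lt (by norm_num) hδ, ← ENNReal.ofReal_inv_of_pos hδ]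
  · congr 2
    norm_num [Real.rpow_neg_one]
  · exact (ae_restrict_iff' measurableSet_Ioi).2 (ae_of_all _ fun u hu => by
      have : 0 < u := hδ.trans hu
      simp only [Pi.zero_apply]; positivity)

/-- Split at distance δ from s: near s use the height bound a, far from s use Hölder with the
normalised L^{4/3} norm. -/
lemma lintegral_rieszKernel_truncated_le {g : ℝ → ℝ≥0∞} (hg : Measurable g)
    (hg1 : ∫⁻ t, g t ^ (4 / 3 : ℝ) ≤ 1) (a : ℝ≥0∞) (s : ℝ) :
    ∫⁻ t, {t | g t ≤ a}.indicator g t * rieszKernel (t - s) ≤ 6 * a ^ (1 / 3 : ℝ) := by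
  rcases eq_or_ne a ⊤ with rfl | ha
  · rw [ENNReal.top_rpow_of_pos (by norm_num), ENNReal.mul_top (by norm_num)]; exact le_top
  rcases eq_or_ne a 0 with rfl | ha0
  · have : (fun t => {t | g t ≤ 0}.indicator g t * rieszKernel (t - s)) = fun _ => 0 := by
      ext t
      by_cases h : g t = 0 <;> simp [h]
    rw [this]; simp
  set G : ℝ → ℝ≥0∞ := {t | g t ≤ a}.indicator g with hG
  have hGm : Measurable G := hg.indicator (measurableSet_le hg measurable_const)
  have hGa : ∀ t, G t ≤ a := fun t => by
    by_cases h : g t ≤ a <;> simp [hG, h]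
  have hGg : ∀ t, G t ≤ g t := fun t => Set.indicator_le_self _ _ _
  -- This δ balances the near bound a·δ^{1/2} against the far bound δ^{-1/4}; both become a^{1/3}.
  set δ : ℝ := a.toReal ^ (-(4 / 3) : ℝ) with hδ'
  have hapos : 0 < a.toReal := ENNReal.toReal_pos ha0 ha
  have hδ : 0 < δ := Real.rpow_pos_of_pos hapos _
  have hδa : ENNReal.ofReal δ = a ^ (-(4 / 3) : ℝ) := by
    rw [hδ', ← ENNReal.ofReal_rpow_of_pos hapos, ENNReal.ofReal_toReal ha]
  have hm : MeasurableSet {u : ℝ | |u| < δ} := measurableSet_lt (by fun_prop) measurable_const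
  have hshift : ∫⁻ t, G t * rieszKernel (t - s) = ∫⁻ u, G (u + s) * rieszKernel u := by
    rw [← lintegral_add_right_eq_self _ s]; simp
  rw [hshift, ← lintegral_add_compl _ hm]
  have h1 : ∫⁻ u in {u : ℝ | |u| < δ}, G (u + s) * rieszKernel u ≤ 4 * a ^ (1 / 3 : ℝ) := by
    calc _ ≤ ∫⁻ u in {u : ℝ | |u| < δ}, a * rieszKernel u :=
          lintegral_mono fun u => mul_le_mul_left (hGa _) _
      _ = a * (4 * a ^ (-(2 / 3) : ℝ)) := by
          rw [lintegral_const_mul _ measurable_rieszKernel, setLIntegral_rieszKernel_near hδ, hδa,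
            ← ENNReal.rpow_mul]
          norm_num
      _ = 4 * a ^ (1 / 3 : ℝ) := by
          rw [mul_left_comm]; congr 1
          nth_rewrite 1 [← ENNReal.rpow_one a]
          rw [← ENNReal.rpow_add _ _ ha0 ha]; norm_num
  have h2 : ∫⁻ u in {u : ℝ | |u| < δ}ᶜ, G (u + s) * rieszKernel u ≤ 2 * a ^ (1 / 3 : ℝ) := by
    have hc : (4 / 3 : ℝ).HolderConjugate 4 := by
      rw [Real.holderConjugate_iff]; norm_num
    calc _ ≤ (∫⁻ u in {u : ℝ | |u| < δ}ᶜ, G (u + s) ^ (4 / 3 : ℝ)) ^ (1 / (4 / 3) : ℝ) *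
          (∫⁻ u in {u : ℝ | |u| < δ}ᶜ, rieszKernel u ^ (4 : ℝ)) ^ (1 / 4 : ℝ) :=
          ENNReal.lintegral_mul_le_Lp_mul_Lq _ hc
            (hGm.comp (measurable_id.add_const s)).aemeasurable
            measurable_rieszKernel.aemeasurable
      _ ≤ 1 ^ (1 / (4 / 3) : ℝ) * (2 * (ENNReal.ofReal δ)⁻¹) ^ (1 / 4 : ℝ) := by
          rw [setLIntegral_rieszKernel_far hδ]
          gcongr
          calc _ ≤ ∫⁻ u, G (u + s) ^ (4 / 3 : ℝ) := setLIntegral_le_lintegral _ _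
            _ = ∫⁻ u, G u ^ (4 / 3 : ℝ) := lintegral_add_right_eq_self (fun u => G u ^ (4 / 3 : ℝ)) s
            _ ≤ ∫⁻ u, g u ^ (4 / 3 : ℝ) := lintegral_mono fun u => by
                  have := hGg u; dsimp only; gcongr
            _ ≤ 1 := hg1
      _ = 2 ^ (1 / 4 : ℝ) * a ^ (1 / 3 : ℝ) := by
          rw [ENNReal.one_rpow, one_mul, ENNReal.mul_rpow_of_nonneg _ _ (by norm_num), hδa,
            ← ENNReal.rpow_neg, ← ENNReal.rpow_mul]
          norm_num
      _ ≤ 2 * a ^ (1 / 3 : ℝ) := by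
          gcongr
          calc (2 : ℝ≥0∞) ^ (1 / 4 : ℝ) ≤ 2 ^ (1 : ℝ) :=
                ENNReal.rpow_le_rpow_of_exponent_le (by norm_num) (by norm_num)
            _ = 2 := ENNReal.rpow_one _
  calc _ ≤ 4 * a ^ (1 / 3 : ℝ) + 2 * a ^ (1 / 3 : ℝ) := add_le_add h1 h2
    _ = 6 * a ^ (1 / 3 : ℝ) := by rw [← add_mul]; norm_num

/-- Where g(t) ≤ f(s), truncating g at height f(s) turns the t-integral into at most 6 f(s)^{1/3},
and the remaining factor f(s) produces f^{4/3}. The opposite region is symmetric, hence 6 + 6. -/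
lemma lintegral_lintegral_rieszKernel_le_of_le_one {f g : ℝ → ℝ≥0∞} (hf : Measurable f)
    (hg : Measurable g) (hf1 : ∫⁻ t, f t ^ (4 / 3 : ℝ) ≤ 1) (hg1 : ∫⁻ t, g t ^ (4 / 3 : ℝ) ≤ 1) :
    ∫⁻ s, ∫⁻ t, f s * g t * rieszKernel (t - s) ≤ 12 := by
  have hK := measurable_rieszKernel
  have half : ∀ {f g : ℝ → ℝ≥0∞}, Measurable f → Measurable g → ∫⁻ t, f t ^ (4 / 3 : ℝ) ≤ 1 →
      ∫⁻ t, g t ^ (4 / 3 : ℝ) ≤ 1 →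
      ∫⁻ s, ∫⁻ t, f s * ({t | g t ≤ f s}.indicator g t * rieszKernel (t - s)) ≤ 6 := by
    intro f g hf hg hf1 hg1
    calc _ ≤ ∫⁻ s, 6 * f s ^ (4 / 3 : ℝ) := by
          refine lintegral_mono fun s => ?_
          dsimp only
          have hm : Measurable fun t => {t | g t ≤ f s}.indicator g t * rieszKernel (t - s) :=
            (hg.indicator (measurableSet_le hg measurable_const)).mul
              (hK.comp (measurable_id.sub_const s))
          rw [lintegral_const_mul _ hm]
          calc _ ≤ f s * (6 * f s ^ (1 / 3 : ℝ)) := by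
                gcongr; exact lintegral_rieszKernel_truncated_le hg hg1 _ _
            _ = 6 * f s ^ (4 / 3 : ℝ) := by
                rw [mul_left_comm]; congr 1
                nth_rewrite 1 [← ENNReal.rpow_one (f s)]
                rw [← ENNReal.rpow_add_of_nonneg _ _ (by norm_num) (by norm_num)]; norm_num
      _ = 6 * ∫⁻ s, f s ^ (4 / 3 : ℝ) := lintegral_const_mul _ (by fun_prop)
      _ ≤ 6 * 1 := by gcongr
      _ = 6 := mul_one _
  have hle : ∀ s t, f s * g t * rieszKernel (t - s) ≤
      f s * ({t | g t ≤ f s}.indicator g t * rieszKernel (t - s)) +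
      g t * ({s | f s ≤ g t}.indicator f s * rieszKernel (s - t)) := by
    intro s t
    rcases le_total (g t) (f s) with h | h
    · refine le_add_right ?_
      simp [h, mul_assoc]
    · refine le_add_left ?_
      simp only [Set.indicator_apply, Set.mem_ofPred_eq, h, if_true, rieszKernel_sub_comm s t]
      exact le_of_eq (by ring)
  have hm1 : Measurable fun p : ℝ × ℝ =>
      f p.1 * ({t | g t ≤ f p.1}.indicator g p.2 * rieszKernel (p.2 - p.1)) := by
    refine (hf.comp measurable_fst).mul (Measurable.mul ?_ (hK.comp (measurable_snd.sub measurable_fst)))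
    exact (hg.comp measurable_snd).indicator
      (measurableSet_le (hg.comp measurable_snd) (hf.comp measurable_fst))
  have hm2 : Measurable fun p : ℝ × ℝ =>
      g p.2 * ({s | f s ≤ g p.2}.indicator f p.1 * rieszKernel (p.1 - p.2)) := by
    refine (hg.comp measurable_snd).mul (Measurable.mul ?_ (hK.comp (measurable_fst.sub measurable_snd)))
    exact (hf.comp measurable_fst).indicator
      (measurableSet_le (hf.comp measurable_fst) (hg.comp measurable_snd))
  calc _ ≤ ∫⁻ s, ∫⁻ t, (f s * ({t | g t ≤ f s}.indicator g t * rieszKernel (t - s)) +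
      g t * ({s | f s ≤ g t}.indicator f s * rieszKernel (s - t))) :=
        lintegral_mono fun s => lintegral_mono fun t => hle s t
    _ = (∫⁻ s, ∫⁻ t, f s * ({t | g t ≤ f s}.indicator g t * rieszKernel (t - s))) +
        ∫⁻ s, ∫⁻ t, g t * ({s | f s ≤ g t}.indicator f s * rieszKernel (s - t)) := by
        rw [← lintegral_add_left hm1.lintegral_prod_right']
        refine lintegral_congr fun s => ?_
        exact lintegral_add_left (hm1.comp measurable_prodMk_left) _
    _ ≤ 6 + 6 := by
        refine add_le_add (half hf hg hf1 hg1) ?_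
        rw [lintegral_lintegral_swap hm2.aemeasurable]
        exact half hg hf hg1 hf1
    _ = 12 := by norm_num

/-- **Hardy–Littlewood–Sobolev inequality** on the line, for the kernel `|t - s|^{-1/2}` and the
exponents `4/3`, `4/3`. -/
theorem lintegral_lintegral_rieszKernel_le {f g : ℝ → ℝ≥0∞} (hf : Measurable f)
    (hg : Measurable g) :
    ∫⁻ s, ∫⁻ t, f s * g t * rieszKernel (t - s) ≤
      12 * (∫⁻ t, f t ^ (4 / 3 : ℝ)) ^ (3 / 4 : ℝ) * (∫⁻ t, g t ^ (4 / 3 : ℝ)) ^ (3 / 4 : ℝ) := by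
  have hK := measurable_rieszKernel
  have zero : ∀ {f : ℝ → ℝ≥0∞}, Measurable f → ∫⁻ t, f t ^ (4 / 3 : ℝ) = 0 → f =ᵐ[volume] 0 := by
    intro f hf h
    rw [lintegral_eq_zero_iff (by fun_prop)] at h
    filter_upwards [h] with t ht
    simpa [ENNReal.rpow_eq_zero_iff, show ¬ ((4 : ℝ) / 3 < 0) by norm_num] using ht
  set F := ∫⁻ t, f t ^ (4 / 3 : ℝ) with hF
  set G := ∫⁻ t, g t ^ (4 / 3 : ℝ) with hG
  -- Zero and infinite norms are removed first, so that normalising by them is legitimate in [0,∞].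
  rcases eq_or_ne F 0 with hF0 | hF0
  · have hz := zero hf hF0
    have : ∫⁻ s, ∫⁻ t, f s * g t * rieszKernel (t - s) = 0 := by
      rw [← lintegral_zero]
      refine lintegral_congr_ae ?_
      filter_upwards [hz] with s hs
      simp [hs]
    rw [this]; exact zero_le
  rcases eq_or_ne G 0 with hG0 | hG0
  · have hz := zero hg hG0
    have : ∫⁻ s, ∫⁻ t, f s * g t * rieszKernel (t - s) = 0 := by
      rw [← lintegral_zero]
      refine lintegral_congr fun s => ?_
      rw [← lintegral_zero]
      refine lintegral_congr_ae ?_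
      filter_upwards [hz] with t ht
      simp [ht]
    rw [this]; exact zero_le
  have pos : ∀ {x : ℝ≥0∞}, x ≠ 0 → x ^ (3 / 4 : ℝ) ≠ 0 := fun {x} hx => by
    simp [ENNReal.rpow_eq_zero_iff, hx, show ¬ ((3 : ℝ) / 4 < 0) by norm_num]
  rcases eq_or_ne F ⊤ with hFt | hFt
  · rw [hFt, ENNReal.top_rpow_of_pos (by norm_num), ENNReal.mul_top (by norm_num),
      ENNReal.top_mul (pos hG0)]; exact le_top
  rcases eq_or_ne G ⊤ with hGt | hGt
  · rw [hGt, ENNReal.top_rpow_of_pos (by norm_num), ENNReal.mul_top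
      (mul_ne_zero (by norm_num) (pos hF0))]; exact le_top
  have fin : ∀ {x : ℝ≥0∞}, x ≠ ⊤ → x ^ (3 / 4 : ℝ) ≠ ⊤ := fun {x} hx =>
    ENNReal.rpow_ne_top_of_nonneg (by norm_num) hx
  have norm1 : ∀ {f : ℝ → ℝ≥0∞}, Measurable f → ∫⁻ t, f t ^ (4 / 3 : ℝ) ≠ 0 →
      ∫⁻ t, f t ^ (4 / 3 : ℝ) ≠ ⊤ →
      ∫⁻ t, (((∫⁻ t, f t ^ (4 / 3 : ℝ)) ^ (3 / 4 : ℝ))⁻¹ * f t) ^ (4 / 3 : ℝ) ≤ 1 := by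
    intro f hf h0 ht
    simp_rw [ENNReal.mul_rpow_of_nonneg _ _ (show (0 : ℝ) ≤ 4 / 3 by norm_num)]
    rw [lintegral_const_mul _ (by fun_prop), ENNReal.inv_rpow, ← ENNReal.rpow_mul]
    norm_num
  have key := lintegral_lintegral_rieszKernel_le_of_le_one
    (f := fun t => (F ^ (3 / 4 : ℝ))⁻¹ * f t) (g := fun t => (G ^ (3 / 4 : ℝ))⁻¹ * g t)
    (by fun_prop) (by fun_prop) (norm1 hf hF0 hFt) (norm1 hg hG0 hGt)
  have hfac : ∀ s t, f s * g t * rieszKernel (t - s) = F ^ (3 / 4 : ℝ) * G ^ (3 / 4 : ℝ) *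
      ((F ^ (3 / 4 : ℝ))⁻¹ * f s * ((G ^ (3 / 4 : ℝ))⁻¹ * g t) * rieszKernel (t - s)) := by
    intro s t
    have e1 := ENNReal.mul_inv_cancel (pos hF0) (fin hFt)
    have e2 := ENNReal.mul_inv_cancel (pos hG0) (fin hGt)
    calc _ = (F ^ (3 / 4 : ℝ) * (F ^ (3 / 4 : ℝ))⁻¹) * (G ^ (3 / 4 : ℝ) * (G ^ (3 / 4 : ℝ))⁻¹) *
          (f s * g t * rieszKernel (t - s)) := by rw [e1, e2]; simp
      _ = _ := by ring
  have hne : F ^ (3 / 4 : ℝ) * G ^ (3 / 4 : ℝ) ≠ ⊤ := ENNReal.mul_ne_top (fin hFt) (fin hGt)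
  calc _ = F ^ (3 / 4 : ℝ) * G ^ (3 / 4 : ℝ) * ∫⁻ s, ∫⁻ t,
      ((F ^ (3 / 4 : ℝ))⁻¹ * f s * ((G ^ (3 / 4 : ℝ))⁻¹ * g t) * rieszKernel (t - s)) := by
        simp_rw [hfac, lintegral_const_mul' _ _ hne]
    _ ≤ F ^ (3 / 4 : ℝ) * G ^ (3 / 4 : ℝ) * 12 := by gcongr
    _ = _ := by ring

/-- A function on the line is in `L⁴` with norm at most `B` as soon as it pairs with the bounded
functions of bounded support as an element of the dual of `L^{4/3}` of norm at most `B`. -/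
lemma lintegral_pow_four_le_of_forall_lintegral_mul_le {w : ℝ → ℝ≥0∞} (hw : Measurable w)
    (B : ℝ≥0∞)
    (H : ∀ (h : ℝ → ℝ≥0∞) (N : ℝ≥0), Measurable h → (∀ t, h t ≤ N) → (∀ t, (N : ℝ) < |t| → h t = 0) →
      ∫⁻ t, h t * w t ≤ B * (∫⁻ t, h t ^ (4 / 3 : ℝ)) ^ (3 / 4 : ℝ)) :
    ∫⁻ t, w t ^ (4 : ℝ) ≤ B ^ (4 : ℝ) := by
  -- Truncation in height and support makes the L⁴ norm finite, so it can be cancelled below;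
  -- monotone convergence removes the truncation.
  set v : ℕ → ℝ → ℝ≥0∞ := fun n => {t : ℝ | |t| ≤ n}.indicator fun t => min (w t) n with hv
  have hset : ∀ n : ℕ, MeasurableSet {t : ℝ | |t| ≤ n} := fun n =>
    measurableSet_le (by fun_prop) measurable_const
  have hvm : ∀ n, Measurable (v n) := fun n => (hw.min measurable_const).indicator (hset n)
  have hvn : ∀ n t, v n t ≤ n := fun n t => by
    by_cases h : |t| ≤ n <;> simp [hv, h]
  have hvw : ∀ n t, v n t ≤ w t := fun n t => by
    by_cases h : |t| ≤ n <;> simp [hv, h]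
  have hv0 : ∀ (n : ℕ) (t : ℝ), (n : ℝ) < |t| → v n t = 0 := fun n t h => by
    simp [hv, h]
  have bound : ∀ n, ∫⁻ t, v n t ^ (4 : ℝ) ≤ B ^ (4 : ℝ) := by
    intro n
    set J := ∫⁻ t, v n t ^ (4 : ℝ) with hJ
    have hJt : J ≠ ⊤ := by
      have : J ≤ ∫⁻ t in {t : ℝ | |t| ≤ n}, (n : ℝ≥0∞) ^ (4 : ℝ) := by
        rw [← lintegral_indicator (hset n)]
        refine lintegral_mono fun t => ?_
        by_cases h : |t| ≤ n
        · simp only [Set.indicator_apply, Set.mem_ofPred_eq, h, if_true]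
          exact ENNReal.rpow_le_rpow (hvn n t) (by norm_num)
        · simp [hv0 n t (not_le.1 h)]
      refine ne_top_of_le_ne_top ?_ this
      rw [setLIntegral_const]
      refine ENNReal.mul_ne_top (ENNReal.rpow_ne_top_of_nonneg (by norm_num) (by simp)) ?_
      have : {t : ℝ | |t| ≤ n} = Set.Icc (-n : ℝ) n := by ext; simp [abs_le]
      rw [this]; simp
    -- The extremal test function is v³: its L^{4/3} norm is J^{3/4}. The parameter N must dominate
    -- both the height n³ and the support radius n.
    have h3 : J ≤ B * J ^ (3 / 4 : ℝ) := by
      have := H (fun t => v n t ^ (3 : ℝ)) (max ((n : ℝ≥0) ^ (3 : ℝ)) n) (by fun_prop)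
        (fun t => by
          have := ENNReal.rpow_le_rpow (hvn n t) (show (0 : ℝ) ≤ 3 by norm_num)
          refine this.trans ?_
          rw [← ENNReal.coe_natCast, ← ENNReal.coe_rpow_of_nonneg _ (by norm_num)]
          exact_mod_cast le_max_left _ _)
        (fun t ht => by
          have : (n : ℝ) < |t| := lt_of_le_of_lt (by exact_mod_cast le_max_right _ _) ht
          rw [hv0 n t this]; exact ENNReal.zero_rpow_of_pos (by norm_num))
      simp_rw [← ENNReal.rpow_mul] at this
      norm_num at this
      refine le_trans (lintegral_mono fun t => ?_) (by norm_num [hJ]; exact this)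
      calc v n t ^ (4 : ℝ) = v n t ^ (3 : ℝ) * v n t := by
            conv_rhs => enter [2]; rw [← ENNReal.rpow_one (v n t)]
            rw [← ENNReal.rpow_add_of_nonneg _ _ (by norm_num) (by norm_num)]; norm_num
        _ = v n t ^ 3 * v n t := by norm_cast
        _ ≤ v n t ^ 3 * w t := mul_le_mul_right (hvw n t) _
    rcases eq_or_ne J 0 with h0 | h0
    · rw [h0]; exact zero_le
    have h4 : J ^ (1 / 4 : ℝ) ≤ B := by
      have hne : J ^ (3 / 4 : ℝ) ≠ 0 := by
        simp [ENNReal.rpow_eq_zero_iff, h0, show ¬ ((3 : ℝ) / 4 < 0) by norm_num]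
      have hnt : J ^ (3 / 4 : ℝ) ≠ ⊤ := ENNReal.rpow_ne_top_of_nonneg (by norm_num) hJt
      rw [← ENNReal.mul_le_mul_iff_left hne hnt, ← ENNReal.rpow_add _ _ h0 hJt]
      norm_num; exact h3
    calc J = (J ^ (1 / 4 : ℝ)) ^ (4 : ℝ) := by rw [← ENNReal.rpow_mul]; norm_num
      _ ≤ _ := by gcongr
  have hmono : ∀ t, Monotone fun n => v n t ^ (4 : ℝ) := by
    intro t m n hmn
    refine ENNReal.rpow_le_rpow ?_ (by norm_num)
    have hmn' : (m : ℝ) ≤ n := by exact_mod_cast hmn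
    have hmn'' : (m : ℝ≥0∞) ≤ n := by exact_mod_cast hmn
    by_cases h : |t| ≤ m
    · have h' : |t| ≤ n := h.trans hmn'
      simp only [hv, Set.indicator_apply, Set.mem_ofPred_eq, h, h', if_true]
      exact min_le_min le_rfl hmn''
    · simp [hv0 m t (not_le.1 h)]
  have hsup : ∀ t, w t ^ (4 : ℝ) = ⨆ n, v n t ^ (4 : ℝ) := by
    intro t
    have hs : ⨆ n, v n t = w t := by
      refine le_antisymm (iSup_le fun n => hvw n t) (le_of_forall_lt fun c hc => ?_)
      obtain ⟨n, hn⟩ := exists_nat_ge |t|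
      obtain ⟨m, hm⟩ := ENNReal.exists_nat_gt hc.ne_top
      refine lt_of_lt_of_le ?_ (le_iSup _ (max n m))
      have h' : |t| ≤ ((max n m : ℕ) : ℝ) := hn.trans (by exact_mod_cast le_max_left _ _)
      simp only [hv, Set.indicator_apply, Set.mem_ofPred_eq, h', if_true]
      exact lt_min hc (hm.trans_le (by exact_mod_cast le_max_right n m))
    have := (ENNReal.orderIsoRpow 4 (by norm_num)).map_iSup (fun n => v n t)
    simpa [hs] using this
  simp_rw [hsup]
  rw [lintegral_iSup (fun n => by fun_prop) (fun m n hmn t => hmono t hmn)]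
  exact iSup_le bound

/-- Fractional integration of order `1/2` maps `L^{4/3}` to `L⁴`. -/
theorem lintegral_lintegral_rieszKernel_pow_four_le {f : ℝ → ℝ≥0∞} (hf : Measurable f) :
    ∫⁻ t, (∫⁻ s, f s * rieszKernel (t - s)) ^ (4 : ℝ) ≤
      (12 * (∫⁻ t, f t ^ (4 / 3 : ℝ)) ^ (3 / 4 : ℝ)) ^ (4 : ℝ) := by
  have hm : Measurable fun p : ℝ × ℝ => f p.2 * rieszKernel (p.1 - p.2) :=
    (hf.comp measurable_snd).mul (measurable_rieszKernel.comp (measurable_fst.sub measurable_snd))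
  refine lintegral_pow_four_le_of_forall_lintegral_mul_le hm.lintegral_prod_right' _ ?_
  intro h N hh _ _
  calc _ = ∫⁻ t, ∫⁻ s, h t * f s * rieszKernel (s - t) := by
        refine lintegral_congr fun t => ?_
        have hmt : Measurable fun s => f s * rieszKernel (t - s) := hm.comp measurable_prodMk_left
        rw [← lintegral_const_mul _ hmt]
        refine lintegral_congr fun s => ?_
        rw [rieszKernel_sub_comm, mul_assoc]
    _ ≤ _ := lintegral_lintegral_rieszKernel_le hh hf
    _ = _ := by ring

/-! ### Oscillatory integrals: decay of the Fourier transform of the circle. -/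

open Real in
/-- Van der Corput estimate for the phase `A cos θ` on a quarter period. -/
lemma norm_integral_exp_cos_quarter_le {A : ℝ} (hA : A ≠ 0) :
    ‖∫ θ in (0 : ℝ)..(π / 2), Complex.exp (Complex.I * (A * cos θ : ℝ))‖ ≤
      5 * |A| ^ (-(1 / 2) : ℝ) := by
  have hA0 : 0 < |A| := abs_pos.2 hA
  have hnorm : ∀ θ : ℝ, ‖Complex.exp (Complex.I * (A * cos θ : ℝ))‖ = 1 := fun θ => by
    rw [mul_comm]; exact Complex.norm_exp_ofReal_mul_I _
  have hcont : Continuous fun θ : ℝ => Complex.exp (Complex.I * (A * cos θ : ℝ)) := by fun_prop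
  rcases le_total |A| 1 with h1 | h1
  -- For |A| ≤ 1 the trivial bound π/2 suffices, since |A|^{-1/2} ≥ 1.
  · have hb := intervalIntegral.norm_integral_le_of_norm_le_const
      (a := 0) (b := π / 2) (C := 1) (f := fun θ : ℝ => Complex.exp (Complex.I * (A * cos θ : ℝ)))
      (fun θ _ => (hnorm θ).le)
    have h2 : 1 ≤ |A| ^ (-(1 / 2) : ℝ) :=
      Real.one_le_rpow_of_pos_of_le_one_of_nonpos hA0 h1 (by norm_num)
    refine hb.trans ?_
    rw [sub_zero, abs_of_pos (by positivity)]
    have := pi_le_four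
    nlinarith
  -- The phase is stationary at θ = 0 only; the interval of length |A|^{-1/2} around it is estimated
  -- trivially.
  set δ : ℝ := |A| ^ (-(1 / 2) : ℝ) with hδ
  have hδ0 : 0 < δ := Real.rpow_pos_of_pos hA0 _
  have hδ1 : δ ≤ 1 := Real.rpow_le_one_of_one_le_of_nonpos h1 (by norm_num)
  have hδA : |A| * δ * δ = 1 := by
    rw [mul_assoc, hδ, ← Real.rpow_add hA0]
    norm_num
    rw [Real.rpow_neg_one]; field_simp
  have hδπ : δ ≤ π / 2 := hδ1.trans (by have := pi_gt_three; linarith)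
  have hsin : ∀ θ ∈ Set.Icc δ (π / 2), 0 < sin θ := fun θ hθ =>
    sin_pos_of_pos_of_lt_pi (hδ0.trans_le hθ.1) (by have := hθ.2; have := pi_pos; linarith)
  have hsplit := intervalIntegral.integral_add_adjacent_intervals
    (hcont.intervalIntegrable (μ := volume) 0 δ) (hcont.intervalIntegrable (μ := volume) δ (π / 2))
  rw [← hsplit]
  have hfirst : ‖∫ θ in (0 : ℝ)..δ, Complex.exp (Complex.I * (A * cos θ : ℝ))‖ ≤ δ := by
    have hb := intervalIntegral.norm_integral_le_of_norm_le_const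
      (a := 0) (b := δ) (C := 1) (f := fun θ : ℝ => Complex.exp (Complex.I * (A * cos θ : ℝ)))
      (fun θ _ => (hnorm θ).le)
    rwa [sub_zero, abs_of_pos hδ0, one_mul] at hb
  -- Integration by parts away from the stationary point: u is chosen so that u·v' = v.
  set u : ℝ → ℂ := fun θ => (Complex.I / A) * ((sin θ)⁻¹ : ℝ) with hu
  set u' : ℝ → ℂ := fun θ => (Complex.I / A) * ((-(cos θ) / sin θ ^ 2 : ℝ) : ℂ) with hu'
  set v : ℝ → ℂ := fun θ => Complex.exp (Complex.I * (A * cos θ : ℝ)) with hv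
  set v' : ℝ → ℂ := fun θ => Complex.exp (Complex.I * (A * cos θ : ℝ)) *
    (Complex.I * (A * (-sin θ) : ℝ)) with hv'
  have huIcc : Set.uIcc δ (π / 2) = Set.Icc δ (π / 2) := Set.uIcc_of_le hδπ
  have hw : ∀ θ ∈ Set.Icc δ (π / 2), HasDerivAt (fun θ => (sin θ)⁻¹) (-(cos θ) / sin θ ^ 2) θ :=
    fun θ hθ => (hasDerivAt_sin θ).inv (hsin θ hθ).ne'
  have hud : ∀ θ ∈ Set.uIcc δ (π / 2), HasDerivAt u (u' θ) θ := fun θ hθ => by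
    rw [huIcc] at hθ
    exact ((hw θ hθ).ofReal_comp).const_mul _
  have hvd : ∀ θ ∈ Set.uIcc δ (π / 2), HasDerivAt v (v' θ) θ := fun θ _ =>
    ((((hasDerivAt_cos θ).const_mul A).ofReal_comp).const_mul Complex.I).cexp
  have hwc : ContinuousOn (fun θ => -(cos θ) / sin θ ^ 2) (Set.uIcc δ (π / 2)) := by
    rw [huIcc]
    exact continuous_cos.neg.continuousOn.div (by fun_prop)
      fun θ hθ => pow_ne_zero _ (hsin θ hθ).ne'
  have hu'c : ContinuousOn u' (Set.uIcc δ (π / 2)) :=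
    continuousOn_const.mul (Complex.continuous_ofReal.comp_continuousOn hwc)
  have hv'c : Continuous v' := by rw [hv']; fun_prop
  have ibp := intervalIntegral.integral_mul_deriv_eq_deriv_mul hud hvd
    hu'c.intervalIntegrable (hv'c.intervalIntegrable _ _)
  have huv : ∫ θ in δ..(π / 2), u θ * v' θ = ∫ θ in δ..(π / 2), v θ := by
    refine intervalIntegral.integral_congr fun θ hθ => ?_
    rw [huIcc] at hθ
    have hs : (sin θ : ℂ) ≠ 0 := by exact_mod_cast (hsin θ hθ).ne'
    have hAc : (A : ℂ) ≠ 0 := by exact_mod_cast hA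
    simp only [hu, hv', hv]
    push_cast at hs ⊢
    field_simp
    rw [Complex.I_sq]; ring
  -- Jordan's inequality: 1/sin δ is comparable to 1/δ, so 1/(|A| sin δ) is of order δ.
  have hsδ : 2 / π * δ ≤ sin δ := mul_le_sin hδ0.le hδπ
  have hsδ0 : 0 < sin δ := hsin δ ⟨le_rfl, hδπ⟩
  have hIA : ‖Complex.I / (A : ℂ)‖ = |A|⁻¹ := by
    rw [norm_div, Complex.norm_I, Complex.norm_real, Real.norm_eq_abs, one_div]
  have hnu : ∀ θ ∈ Set.Icc δ (π / 2), ‖u θ‖ = |A|⁻¹ * (sin θ)⁻¹ := fun θ hθ => by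
    rw [hu]
    simp only [norm_mul, hIA, Complex.norm_real, Real.norm_eq_abs]
    rw [abs_of_pos (inv_pos.2 (hsin θ hθ))]
  -- 1/sin is monotone on the interval, so the integral of |u'| telescopes to boundary values.
  have hint : ‖∫ θ in δ..(π / 2), u' θ * v θ‖ ≤ |A|⁻¹ * ((sin δ)⁻¹ - 1) := by
    calc _ ≤ ∫ θ in δ..(π / 2), |A|⁻¹ * -(-(cos θ) / sin θ ^ 2) := by
          refine intervalIntegral.norm_integral_le_of_norm_le hδπ ?_
            (continuousOn_const.mul hwc.neg).intervalIntegrable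
          refine ae_of_all _ fun θ hθ => ?_
          have hc : 0 ≤ cos θ := cos_nonneg_of_neg_pi_div_two_le_of_le
            (by have := hθ.1; have := pi_pos; linarith) hθ.2
          rw [norm_mul, hv, hnorm, mul_one, hu']
          simp only [norm_mul, hIA, Complex.norm_real, Real.norm_eq_abs]
          have hq := div_nonneg hc (sq_nonneg (sin θ))
          rw [abs_of_nonpos (show -cos θ / sin θ ^ 2 ≤ 0 by rw [neg_div]; linarith)]
      _ = |A|⁻¹ * ((sin δ)⁻¹ - 1) := by
          rw [intervalIntegral.integral_const_mul, intervalIntegral.integral_neg,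
            intervalIntegral.integral_eq_sub_of_hasDerivAt (f := fun θ => (sin θ)⁻¹)
              (fun θ hθ => hw θ (huIcc ▸ hθ)) hwc.intervalIntegrable]
          simp
  have hsecond : ‖∫ θ in δ..(π / 2), v θ‖ ≤ |A|⁻¹ * 2 * (sin δ)⁻¹ := by
    rw [← huv, ibp]
    calc _ ≤ ‖u (π / 2) * v (π / 2)‖ + ‖u δ * v δ‖ + ‖∫ θ in δ..(π / 2), u' θ * v θ‖ :=
          (norm_sub_le _ _).trans (add_le_add_left (norm_sub_le _ _) _)
      _ ≤ |A|⁻¹ * (sin (π / 2))⁻¹ + |A|⁻¹ * (sin δ)⁻¹ + |A|⁻¹ * ((sin δ)⁻¹ - 1) := by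
          have hnv : ∀ θ, ‖v θ‖ = 1 := hnorm
          rw [norm_mul (u _), norm_mul (u _), hnv, hnv, mul_one, mul_one,
            hnu _ ⟨hδπ, le_rfl⟩, hnu _ ⟨le_rfl, hδπ⟩]
          gcongr
      _ = _ := by rw [sin_pi_div_two]; ring
  have hfin : |A|⁻¹ * 2 * (sin δ)⁻¹ ≤ 4 * δ := by
    have hAinv : |A|⁻¹ = δ * δ := by
      rw [inv_eq_iff_eq_inv, eq_comm]; field_simp; nlinarith
    have : (sin δ)⁻¹ ≤ π / 2 * δ⁻¹ := by
      rw [← inv_le_inv₀ (by positivity) (by positivity)] at hsδ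
      refine hsδ.trans (le_of_eq ?_)
      field_simp
    calc _ ≤ δ * δ * 2 * (π / 2 * δ⁻¹) := by rw [hAinv]; gcongr
      _ = π * δ := by field_simp
      _ ≤ 4 * δ := by gcongr; exact pi_le_four
  calc _ ≤ δ + 4 * δ := (norm_add_le _ _).trans (add_le_add hfirst (hsecond.trans hfin))
    _ = 5 * δ := by ring

-- The circle is cut into four quarters: θ ↦ π - θ replaces A by -A, and evenness of cos handles the
-- negative half.
open Real in
lemma norm_integral_exp_cos_le {A : ℝ} (hA : A ≠ 0) :
    ‖∫ θ in (-π)..π, Complex.exp (Complex.I * (A * cos θ : ℝ))‖ ≤ 20 * |A| ^ (-(1 / 2) : ℝ) := by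
  set v : ℝ → ℝ → ℂ := fun A θ => Complex.exp (Complex.I * (A * cos θ : ℝ)) with hv
  have hc : ∀ A, Continuous (v A) := fun A => by simp only [hv]; fun_prop
  have hi : ∀ A a b, IntervalIntegrable (v A) volume a b := fun A a b =>
    (hc A).intervalIntegrable a b
  have e1 : ∫ θ in (π / 2)..π, v A θ = ∫ θ in (0 : ℝ)..(π / 2), v (-A) θ := by
    have := intervalIntegral.integral_comp_sub_left (a := 0) (b := π / 2) (v A) π
    rw [sub_zero, show π - π / 2 = π / 2 by ring] at this
    rw [← this]
    refine intervalIntegral.integral_congr fun θ _ => ?_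
    simp only [hv, cos_pi_sub]; congr 3; ring
  have e2 : ∫ θ in (-π)..0, v A θ = ∫ θ in (0 : ℝ)..π, v A θ := by
    have := intervalIntegral.integral_comp_neg (a := 0) (b := π) (v A)
    rw [neg_zero] at this
    rw [← this]
    refine intervalIntegral.integral_congr fun θ _ => ?_
    simp only [hv, cos_neg]
  have e3 := intervalIntegral.integral_add_adjacent_intervals (hi A (-π) 0) (hi A 0 π)
  have e4 := intervalIntegral.integral_add_adjacent_intervals (hi A 0 (π / 2)) (hi A (π / 2) π)
  have b1 := norm_integral_exp_cos_quarter_le hA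
  have b2 := norm_integral_exp_cos_quarter_le (neg_ne_zero.2 hA)
  rw [abs_neg] at b2
  change ‖∫ θ in (-π)..π, v A θ‖ ≤ _
  rw [← e3, e2, ← e4, e1]
  have t1 := norm_add_le (∫ θ in (0 : ℝ)..(π / 2), v A θ) (∫ θ in (0 : ℝ)..(π / 2), v (-A) θ)
  have t2 := norm_add_le
    ((∫ θ in (0 : ℝ)..(π / 2), v A θ) + (∫ θ in (0 : ℝ)..(π / 2), v (-A) θ))
    ((∫ θ in (0 : ℝ)..(π / 2), v A θ) + (∫ θ in (0 : ℝ)..(π / 2), v (-A) θ))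
  linarith

open Real in
/-- Decay of the Fourier transform of the circle (a Bessel function). -/
lemma enorm_integral_exp_circle_le (z : ℂ) :
    ‖∫ θ in Set.Ioo (-π) π, Complex.exp (Complex.I * (z.re * cos θ + z.im * sin θ : ℝ))‖ₑ ≤
      20 * rieszKernel ‖z‖ := by
  -- At z = 0 the right side is infinite, because 0^{-1/2} = ∞ in `ℝ≥0∞`.
  rcases eq_or_ne z 0 with rfl | hz
  · simp [rieszKernel, ENNReal.zero_rpow_of_neg]
  have hz' : ‖z‖ ≠ 0 := norm_ne_zero_iff.2 hz
  have key := norm_integral_exp_cos_le hz'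
  set g : ℝ → ℂ := fun θ => Complex.exp (Complex.I * (‖z‖ * cos θ : ℝ)) with hg
  have hper : Function.Periodic g (2 * π) := fun θ => by simp only [hg, cos_add_two_pi]
  have e : ∫ θ in Set.Ioo (-π) π, Complex.exp (Complex.I * (z.re * cos θ + z.im * sin θ : ℝ)) =
      ∫ θ in (-π)..π, g θ := by
    rw [← integral_Ioc_eq_integral_Ioo, ← intervalIntegral.integral_of_le (by linarith [pi_pos])]
    -- The phase is ‖z‖ cos(θ - arg z); periodicity then removes the rotation.
    have h1 : ∀ θ : ℝ, Complex.exp (Complex.I * (z.re * cos θ + z.im * sin θ : ℝ)) =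
        g (θ - z.arg) := fun θ => by
      simp only [hg]
      congr 3
      have h1 := Complex.norm_mul_cos_arg z
      have h2 := Complex.norm_mul_sin_arg z
      rw [cos_sub]
      linear_combination -cos θ * h1 - sin θ * h2
    simp_rw [h1]
    rw [intervalIntegral.integral_comp_sub_right]
    have := hper.intervalIntegral_add_eq (-π - z.arg) (-π)
    rw [show -π - z.arg + 2 * π = π - z.arg by ring, show -π + 2 * π = π by ring] at this
    exact this
  rw [e, ← ofReal_norm]
  refine (ENNReal.ofReal_le_ofReal key).trans (le_of_eq ?_)
  have hp : 0 < |‖z‖| := abs_pos.2 hz'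
  rw [ENNReal.ofReal_mul (by norm_num), rieszKernel, ENNReal.ofReal_rpow_of_pos hp]
  simp

/-! ### The dispersive estimate on an annulus. -/

/-- The plane wave `e^{i(2π x·η + t λ(η))}` solving the dispersive equation with symbol `λ`. -/
noncomputable def wave (lam : Plane → ℝ) (t : ℝ) (x η : Plane) : ℂ :=
  Complex.exp (Complex.I * (2 * Real.pi * inner ℝ x η + t * lam η : ℝ))

/-- The frequency annulus `a ≤ |η| ≤ 4a`. -/
def annulus (a : ℝ) : Set Plane := {η | a ≤ ‖η‖ ∧ ‖η‖ ≤ 4 * a}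

lemma measurableSet_annulus (a : ℝ) : MeasurableSet (annulus a) :=
  (measurableSet_le measurable_const measurable_norm).inter
    (measurableSet_le measurable_norm measurable_const)

lemma norm_wave (lam : Plane → ℝ) (t : ℝ) (x η : Plane) : ‖wave lam t x η‖ = 1 := by
  unfold wave; rw [mul_comm]; exact Complex.norm_exp_ofReal_mul_I _

-- Polar coordinates. Since Λ_κ depends only on the direction, the phase on each circle is linear in
-- (cos θ, sin θ), so the inner integral is the Fourier transform of the circle at 2πρx + κt e₁.
open Real in
lemma setIntegral_annulus_wave_eq {a : ℝ} (ha : 0 < a) (κ t : ℝ) (x : Plane) :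
    ∫ η in annulus a, wave (dispersion κ) t x η = ∫ ρ in Set.Icc a (4 * a), (ρ : ℂ) *
      ∫ θ in Set.Ioo (-π) π, Complex.exp (Complex.I *
        ((2 * π * ρ * x 0 + κ * t) * cos θ + (2 * π * ρ * x 1) * sin θ : ℝ)) := by
  have hT : ∀ z : ℂ, Complex.orthonormalBasisOneI.repr z = !₂[z.re, z.im] :=
    fun _ => rfl
  rw [← integral_indicator (measurableSet_annulus a),
    ← (Complex.orthonormalBasisOneI.repr.measurePreserving).integral_comp
      Complex.orthonormalBasisOneI.repr.toHomeomorph.measurableEmbedding,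
    ← Complex.integral_comp_polarCoord_symm]
  set h : ℝ → ℝ → ℂ := fun ρ θ => (ρ : ℂ) * Complex.exp (Complex.I *
        ((2 * π * ρ * x 0 + κ * t) * cos θ + (2 * π * ρ * x 1) * sin θ : ℝ)) with hh
  have hpt : ∀ p ∈ polarCoord.target, p.1 • (annulus a).indicator (wave (dispersion κ) t x)
      (Complex.orthonormalBasisOneI.repr (Complex.polarCoord.symm p)) =
      (Set.Icc a (4 * a) ×ˢ (Set.univ : Set ℝ)).indicator (fun p => h p.1 p.2) p := by
    rintro ⟨ρ, θ⟩ hp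
    have hρ : 0 < ρ := hp.1
    have hn : ‖Complex.orthonormalBasisOneI.repr (Complex.polarCoord.symm (ρ, θ))‖ = ρ := by
      rw [LinearIsometryEquiv.norm_map, Complex.norm_polarCoord_symm, abs_of_pos hρ]
    have hmem : Complex.orthonormalBasisOneI.repr (Complex.polarCoord.symm (ρ, θ)) ∈ annulus a ↔
        ρ ∈ Set.Icc a (4 * a) := by
      simp only [annulus, Set.mem_ofPred_eq, hn, Set.mem_Icc]
    by_cases hm : ρ ∈ Set.Icc a (4 * a)
    · rw [Set.indicator_of_mem (hmem.2 hm), Set.indicator_of_mem (Set.mk_mem_prod hm (Set.mem_univ _))]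
      simp only [hh, wave, dispersion, hn, Complex.real_smul]
      congr 4
      rw [hT]
      simp only [Complex.polarCoord_symm_apply, PiLp.inner_apply, Fin.sum_univ_two]
      simp [-Complex.ofReal_cos, -Complex.ofReal_sin]
      field_simp
      ring
    · rw [Set.indicator_of_notMem (fun h => hm (hmem.1 h)),
        Set.indicator_of_notMem (fun h => hm h.1), smul_zero]
  rw [setIntegral_congr_fun polarCoord.open_target.measurableSet hpt,
    setIntegral_indicator (measurableSet_Icc.prod MeasurableSet.univ)]
  have hset : polarCoord.target ∩ Set.Icc a (4 * a) ×ˢ Set.univ =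
      Set.Icc a (4 * a) ×ˢ Set.Ioo (-π) π := by
    rw [polarCoord_target, Set.prod_inter_prod, Set.inter_univ]
    congr 1
    ext ρ
    simp only [Set.mem_inter_iff, Set.mem_Ioi, Set.mem_Icc]
    exact ⟨And.right, fun h => ⟨ha.trans_le h.1, h⟩⟩
  have hcont : Continuous fun p : ℝ × ℝ => h p.1 p.2 := by simp only [hh]; fun_prop
  have hint : IntegrableOn (fun p : ℝ × ℝ => h p.1 p.2)
      (Set.Icc a (4 * a) ×ˢ Set.Ioo (-π) π) (volume.prod volume) :=
    (hcont.continuousOn.integrableOn_compact (μ := volume.prod volume)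
      (isCompact_Icc.prod isCompact_Icc)).mono_set
      (Set.prod_mono_right Set.Ioo_subset_Icc_self)
  rw [hset, Measure.volume_eq_prod, setIntegral_prod _ hint]
  refine integral_congr_ae (ae_of_all _ fun ρ => ?_)
  simp only [hh]
  exact integral_const_mul _ _

lemma rieszKernel_antitone {u v : ℝ} (h : |u| ≤ |v|) : rieszKernel v ≤ rieszKernel u := by
  unfold rieszKernel
  rw [ENNReal.rpow_neg, ENNReal.rpow_neg, ENNReal.inv_le_inv]
  exact ENNReal.rpow_le_rpow (ENNReal.ofReal_le_ofReal h) (by norm_num)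

lemma rieszKernel_mul {c : ℝ} (hc : 0 < c) (u : ℝ) :
    rieszKernel (c * u) = ENNReal.ofReal (c ^ (-(1 / 2) : ℝ)) * rieszKernel u := by
  unfold rieszKernel
  rw [abs_mul, abs_of_pos hc, ENNReal.ofReal_mul hc.le,
    ENNReal.mul_rpow_of_ne_top ENNReal.ofReal_ne_top ENNReal.ofReal_ne_top,
    ENNReal.ofReal_rpow_of_pos hc]

/-- The bound is uniform in the position r of the singularity: within distance a the kernel
integrates to 4a^{1/2}, elsewhere it is at most a^{-1/2} on an interval of length 3a. -/
lemma setLIntegral_Icc_rieszKernel_le {a : ℝ} (ha : 0 < a) (r : ℝ) :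
    ∫⁻ ρ in Set.Icc a (4 * a), rieszKernel (ρ - r) ≤ ENNReal.ofReal (7 * a ^ (1 / 2 : ℝ)) := by
  have hm : MeasurableSet {u : ℝ | |u| < a} := measurableSet_lt (by fun_prop) measurable_const
  have hle : ∀ ρ, rieszKernel (ρ - r) ≤
      {u : ℝ | |u| < a}.indicator rieszKernel (ρ - r) + ENNReal.ofReal (a ^ (-(1 / 2) : ℝ)) := by
    intro ρ
    by_cases h : |ρ - r| < a
    · simp [h]
    · refine le_add_left ?_
      have := rieszKernel_antitone (u := a) (v := ρ - r) (by rw [abs_of_pos ha]; exact not_lt.1 h)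
      refine this.trans (le_of_eq ?_)
      rw [rieszKernel, abs_of_pos ha, ENNReal.ofReal_rpow_of_pos ha]
  calc _ ≤ ∫⁻ ρ in Set.Icc a (4 * a), ({u : ℝ | |u| < a}.indicator rieszKernel (ρ - r) +
        ENNReal.ofReal (a ^ (-(1 / 2) : ℝ))) := lintegral_mono hle
    _ = (∫⁻ ρ in Set.Icc a (4 * a), {u : ℝ | |u| < a}.indicator rieszKernel (ρ - r)) +
        ENNReal.ofReal (a ^ (-(1 / 2) : ℝ)) * ENNReal.ofReal (3 * a) := by
        rw [lintegral_add_right _ measurable_const, setLIntegral_const, Real.volume_Icc]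
        congr 3; ring
    _ ≤ (∫⁻ ρ, {u : ℝ | |u| < a}.indicator rieszKernel (ρ - r)) +
        ENNReal.ofReal (a ^ (-(1 / 2) : ℝ)) * ENNReal.ofReal (3 * a) := by
        gcongr; exact Measure.restrict_le_self
    _ = ENNReal.ofReal (4 * a ^ (1 / 2 : ℝ)) + ENNReal.ofReal (a ^ (-(1 / 2) : ℝ) * (3 * a)) := by
        rw [lintegral_sub_right_eq_self, lintegral_indicator hm, setLIntegral_rieszKernel_near ha,
          ENNReal.ofReal_rpow_of_pos ha, ← ENNReal.ofReal_mul (by positivity),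
          ENNReal.ofReal_mul (p := 4) (by norm_num)]
        simp
    _ = _ := by
        rw [← ENNReal.ofReal_add (by positivity) (by positivity)]
        congr 1
        have : a ^ (-(1 / 2) : ℝ) * a = a ^ (1 / 2 : ℝ) := by
          nth_rewrite 2 [← Real.rpow_one a]
          rw [← Real.rpow_add ha]; norm_num
        linear_combination 3 * this

open Real in
/-- **Dispersive estimate**: the kernel of `e^{itΛ_κ}` localised to the annulus `a ≤ |η| ≤ 4a`
is bounded by a multiple of `a² |κ t|^{-1/2}`, uniformly in space. -/
theorem enorm_setIntegral_annulus_wave_le {a : ℝ} (ha : 0 < a) (κ t : ℝ) (x : Plane) :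
    ‖∫ η in annulus a, wave (dispersion κ) t x η‖ₑ ≤
      ENNReal.ofReal (1680 * a ^ 2) * rieszKernel (κ * t) := by
  set τ := κ * t with hτ
  rcases eq_or_ne τ 0 with h0 | h0
  · have : rieszKernel τ = ⊤ := by simp [h0, rieszKernel, ENNReal.zero_rpow_of_neg]
    rw [this, ENNReal.mul_top (by simpa using by positivity)]
    exact le_top
  have hτ0 : 0 < |τ| := abs_pos.2 h0
  -- The point at which the Fourier transform of the circle of radius ρ is evaluated, as a complex
  -- number.
  set z : ℝ → ℂ := fun ρ => ⟨2 * π * ρ * x 0 + τ, 2 * π * ρ * x 1⟩ with hz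
  rw [setIntegral_annulus_wave_eq ha]
  have hstep : ‖∫ ρ in Set.Icc a (4 * a), (ρ : ℂ) *
      ∫ θ in Set.Ioo (-π) π, Complex.exp (Complex.I *
        ((2 * π * ρ * x 0 + κ * t) * cos θ + (2 * π * ρ * x 1) * sin θ : ℝ))‖ₑ ≤
      ∫⁻ ρ in Set.Icc a (4 * a), ENNReal.ofReal (4 * a) * (20 * rieszKernel ‖z ρ‖) := by
    refine (enorm_integral_le_lintegral_enorm _).trans ?_
    refine setLIntegral_mono' measurableSet_Icc fun ρ hρ => ?_
    rw [enorm_mul]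
    refine mul_le_mul' ?_ (enorm_integral_exp_circle_le (z ρ))
    rw [← ofReal_norm, Complex.norm_real, Real.norm_eq_abs, abs_of_pos (ha.trans_le hρ.1)]
    exact ENNReal.ofReal_le_ofReal hρ.2
  refine hstep.trans ?_
  have hzre : ∀ ρ, (z ρ).re = 2 * π * ρ * x 0 + τ := fun _ => rfl
  have hzim : ∀ ρ, (z ρ).im = 2 * π * ρ * x 1 := fun _ => rfl
  have hxn : ‖x‖ ^ 2 = x 0 ^ 2 + x 1 ^ 2 := by
    rw [EuclideanSpace.norm_sq_eq]; simp [Fin.sum_univ_two]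
  have hx0 : |x 0| ≤ ‖x‖ := abs_le_of_sq_le_sq (by nlinarith [sq_nonneg (x 1)]) (norm_nonneg _)
  -- in both regimes the modulus of the phase vector is at least `|τ| / (8 a) * |ρ - r|`, or `|τ| / 2`
  rcases le_or_gt (16 * π * a * ‖x‖) |τ| with hx | hx
  · have hb : ∀ ρ ∈ Set.Icc a (4 * a), rieszKernel ‖z ρ‖ ≤ rieszKernel (1 / 2 * τ) := by
      intro ρ hρ
      refine rieszKernel_antitone ?_
      rw [abs_mul, abs_norm, abs_of_pos (by norm_num : (0 : ℝ) < 1 / 2)]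
      refine le_trans ?_ (Complex.abs_re_le_norm _)
      rw [hzre]
      have h1 : |2 * π * ρ * x 0| ≤ |τ| / 2 := by
        rw [abs_mul, abs_of_pos (by have := ha.trans_le hρ.1; positivity)]
        have : ρ * |x 0| ≤ 4 * a * ‖x‖ :=
          mul_le_mul hρ.2 hx0 (abs_nonneg _) (by positivity)
        nlinarith [pi_pos]
      have h2 := abs_sub_abs_le_abs_sub τ (-(2 * π * ρ * x 0))
      rw [abs_neg, sub_neg_eq_add, add_comm τ] at h2
      linarith
    calc _ ≤ ∫⁻ ρ in Set.Icc a (4 * a), ENNReal.ofReal (4 * a) * (20 * rieszKernel (1 / 2 * τ)) :=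
          setLIntegral_mono' measurableSet_Icc fun ρ hρ => by gcongr; exact hb ρ hρ
      _ = ENNReal.ofReal (4 * a * 20 * (1 / 2 : ℝ) ^ (-(1 / 2) : ℝ) * (3 * a)) * rieszKernel τ := by
          rw [setLIntegral_const, Real.volume_Icc, rieszKernel_mul (by norm_num),
            show 4 * a - a = 3 * a by ring,
            ENNReal.ofReal_mul (p := 4 * a * 20 * (1 / 2 : ℝ) ^ (-(1 / 2) : ℝ)) (by positivity),
            ENNReal.ofReal_mul (p := 4 * a * 20) (by positivity),
            ENNReal.ofReal_mul (p := 4 * a) (by positivity),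
            show ENNReal.ofReal 20 = 20 by simp]
          ring
      _ ≤ _ := by
          refine mul_le_mul_left (ENNReal.ofReal_le_ofReal ?_) _
          have : (1 / 2 : ℝ) ^ (-(1 / 2) : ℝ) ≤ 2 := by
            rw [one_div, Real.inv_rpow (by norm_num), ← Real.rpow_neg (by norm_num)]
            calc (2 : ℝ) ^ (- -(2 : ℝ)⁻¹) ≤ 2 ^ (1 : ℝ) :=
                  Real.rpow_le_rpow_of_exponent_le (by norm_num) (by norm_num)
              _ = 2 := Real.rpow_one _
          nlinarith [sq_nonneg a, mul_le_mul_of_nonneg_left this (sq_nonneg a)]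
  · have hxpos : 0 < ‖x‖ := by
      have : 0 < 16 * π * a * ‖x‖ := hτ0.trans hx
      exact pos_of_mul_pos_right this (by positivity)
    -- The radius at which z(ρ) is orthogonal to x, that is, where the line ρ ↦ z(ρ) is closest to
    -- the origin.
    set r : ℝ := -(τ * x 0) / (2 * π * ‖x‖ ^ 2) with hr
    have hc : 0 < |τ| / (8 * a) := by positivity
    have hb : ∀ ρ, rieszKernel ‖z ρ‖ ≤ rieszKernel (|τ| / (8 * a) * (ρ - r)) := by
      intro ρ
      refine rieszKernel_antitone ?_
      rw [abs_mul, abs_norm, abs_of_pos hc]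
      -- Cauchy–Schwarz: |z(ρ)| is at least its component along x, which is 2π‖x‖(ρ - r) up to sign.
      have hcs : ‖x‖ * |2 * π * ‖x‖ * (ρ - r)| ≤ ‖x‖ * ‖z ρ‖ := by
        have e : ‖x‖ * (2 * π * ‖x‖ * (ρ - r)) =
            (2 * π * ρ * x 0 + τ) * x 0 + (2 * π * ρ * x 1) * x 1 := by
          rw [hr]; field_simp; rw [hxn]; ring
        rw [← abs_norm x, ← abs_mul, abs_norm, e]
        refine abs_le_of_sq_le_sq ?_ (by positivity)
        rw [mul_pow, hxn, Complex.sq_norm, Complex.normSq_apply, hzre, hzim]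
        nlinarith [sq_nonneg ((2 * π * ρ * x 0 + τ) * x 1 - (2 * π * ρ * x 1) * x 0)]
      have h1 := le_of_mul_le_mul_left hcs hxpos
      rw [abs_mul, abs_of_pos (by positivity)] at h1
      refine le_trans ?_ h1
      gcongr
      rw [div_le_iff₀ (by positivity)]
      linarith
    calc _ ≤ ∫⁻ ρ in Set.Icc a (4 * a), ENNReal.ofReal (4 * a) * (20 *
          (ENNReal.ofReal ((|τ| / (8 * a)) ^ (-(1 / 2) : ℝ)) * rieszKernel (ρ - r))) :=
          lintegral_mono fun ρ => by
            have := hb ρ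
            rw [rieszKernel_mul hc] at this
            dsimp only; gcongr
      _ = ENNReal.ofReal (4 * a) * (20 * (ENNReal.ofReal ((|τ| / (8 * a)) ^ (-(1 / 2) : ℝ)) *
          ∫⁻ ρ in Set.Icc a (4 * a), rieszKernel (ρ - r))) := by
          rw [lintegral_const_mul' _ _ ENNReal.ofReal_ne_top,
            lintegral_const_mul' _ _ (by norm_num), lintegral_const_mul' _ _ ENNReal.ofReal_ne_top]
      _ ≤ ENNReal.ofReal (4 * a) * (20 * (ENNReal.ofReal ((|τ| / (8 * a)) ^ (-(1 / 2) : ℝ)) *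
          ENNReal.ofReal (7 * a ^ (1 / 2 : ℝ)))) := by
          gcongr; exact setLIntegral_Icc_rieszKernel_le ha r
      _ = ENNReal.ofReal (4 * a * (20 * ((|τ| / (8 * a)) ^ (-(1 / 2) : ℝ) *
          (7 * a ^ (1 / 2 : ℝ))))) := by
          rw [show (20 : ℝ≥0∞) = ENNReal.ofReal 20 by simp, ← ENNReal.ofReal_mul (by positivity),
            ← ENNReal.ofReal_mul (by positivity), ← ENNReal.ofReal_mul (by positivity)]
      -- 4·20·7 = 560 and √8 ≤ 3 give 1680.
      _ ≤ ENNReal.ofReal (1680 * a ^ 2 * |τ| ^ (-(1 / 2) : ℝ)) := by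
          apply ENNReal.ofReal_le_ofReal
          have h8 : (8 : ℝ) ^ (1 / 2 : ℝ) ≤ 3 := by
            rw [← Real.sqrt_eq_rpow, Real.sqrt_le_left (by norm_num)]; norm_num
          have e1 : (|τ| / (8 * a)) ^ (-(1 / 2) : ℝ) =
              |τ| ^ (-(1 / 2) : ℝ) * (8 ^ (1 / 2 : ℝ) * a ^ (1 / 2 : ℝ)) := by
            rw [Real.div_rpow hτ0.le (by positivity), Real.mul_rpow (by norm_num) ha.le,
              Real.rpow_neg (by norm_num : (0 : ℝ) ≤ 8), Real.rpow_neg ha.le]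
            field_simp
          have e2 : a ^ (1 / 2 : ℝ) * a ^ (1 / 2 : ℝ) = a := by
            rw [← Real.rpow_add ha]; norm_num
          have hT : 0 ≤ |τ| ^ (-(1 / 2) : ℝ) := by positivity
          calc 4 * a * (20 * ((|τ| / (8 * a)) ^ (-(1 / 2) : ℝ) * (7 * a ^ (1 / 2 : ℝ))))
              = 560 * (8 : ℝ) ^ (1 / 2 : ℝ) * (a * (a ^ (1 / 2 : ℝ) * a ^ (1 / 2 : ℝ))) *
                |τ| ^ (-(1 / 2) : ℝ) := by rw [e1]; ring
            _ = 560 * (8 : ℝ) ^ (1 / 2 : ℝ) * a ^ 2 * |τ| ^ (-(1 / 2) : ℝ) := by rw [e2]; ring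
            _ ≤ 1680 * a ^ 2 * |τ| ^ (-(1 / 2) : ℝ) := by
                gcongr; linarith
      _ = _ := by
          rw [ENNReal.ofReal_mul (by positivity), rieszKernel, ENNReal.ofReal_rpow_of_pos hτ0]

/-! ### Plancherel for functions in `L¹ ∩ L²` -/

/-- The L² extension of the inverse transform and the absolutely convergent integral pair
identically with every test function, so they agree almost everywhere; the L² extension is an
isometry. -/
lemma eLpNorm_fourierInv_le {Φ : Plane → ℂ} (h1 : Integrable Φ) (h2 : MemLp Φ 2 volume) :
    eLpNorm (𝓕⁻ Φ) 2 volume ≤ eLpNorm Φ 2 volume := by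
  set L : Lp ℂ 2 (volume : Measure Plane) := 𝓕⁻ (h2.toLp Φ) with hL
  have hcont : Continuous (𝓕⁻ Φ) := by
    rw [Real.fourierInv_eq_fourier_comp_neg]
    exact VectorFourier.fourierIntegral_continuous Real.continuous_fourierChar
      (by exact continuous_inner) h1.comp_neg
  have hae : ∀ᵐ x ∂(volume : Measure Plane), L x = 𝓕⁻ Φ x := by
    refine ae_eq_of_integral_contDiff_smul_eq
      ((Lp.memLp L).locallyIntegrable (by norm_num)) hcont.locallyIntegrable fun g hg hgc => ?_
    have hgc' : HasCompactSupport fun x => (g x : ℂ) := hgc.comp_left (g := ((↑) : ℝ → ℂ)) rfl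
    set G : 𝓢(Plane, ℂ) := hgc'.toSchwartzMap (Complex.ofRealCLM.contDiff.comp hg) with hG
    have hGg : ∀ x, G x = g x := fun x => rfl
    have e1 : (L : 𝓢'(Plane, ℂ)) G = ∫ x, G x • L x := Lp.toTemperedDistribution_apply _ _
    have e2 : (L : 𝓢'(Plane, ℂ)) G = ∫ x, (𝓕⁻ G) x • Φ x := by
      rw [hL, ← Lp.fourierInv_toTemperedDistribution_eq, TemperedDistribution.fourierInv_apply,
        Lp.toTemperedDistribution_apply]
      refine integral_congr_ae ?_
      filter_upwards [h2.coeFn_toLp] with x hx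
      rw [hx]
    have e3 : ∫ x, (𝓕⁻ G) x • Φ x = ∫ x, G x • 𝓕⁻ Φ x := by
      have hsw := VectorFourier.integral_fourierIntegral_smul_eq_flip (μ := volume) (ν := volume)
        (L := -innerₗ Plane) (f := G) (g := Φ) Real.continuous_fourierChar
        (continuous_inner (𝕜 := ℝ) (E := Plane)).neg G.integrable h1
      have a1 : ∀ x, (𝓕⁻ G) x = VectorFourier.fourierIntegral Real.fourierChar volume
          (-innerₗ Plane) G x := fun x => by
        rw [SchwartzMap.fourierInv_coe]; rfl
      have a2 : ∀ x, 𝓕⁻ Φ x = VectorFourier.fourierIntegral Real.fourierChar volume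
          (-innerₗ Plane).flip Φ x := fun x => by
        have : (-innerₗ Plane).flip = -innerₗ Plane := by
          ext u v; simp [real_inner_comm]
        rw [this]; rfl
      simp_rw [a1, a2]
      exact hsw
    have e4 := e1.symm.trans (e2.trans e3)
    simpa [hGg] using e4
  rw [← eLpNorm_congr_ae hae]
  have hn : ‖L‖ = ‖h2.toLp Φ‖ := (Lp.fourierTransformₗᵢ Plane ℂ).symm.norm_map _
  rw [Lp.norm_toLp, Lp.norm_def] at hn
  rw [← ENNReal.toReal_le_toReal (Lp.eLpNorm_ne_top L) h2.eLpNorm_ne_top]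
  exact hn.le

lemma eLpNorm_fourier_le {Φ : Plane → ℂ} (h1 : Integrable Φ) (h2 : MemLp Φ 2 volume) :
    eLpNorm (𝓕 Φ) 2 volume ≤ eLpNorm Φ 2 volume := by
  have e : 𝓕 Φ = (𝓕⁻ Φ) ∘ Neg.neg := by
    ext x; simp [Real.fourierInv_eq_fourier_neg]
  have hm : AEStronglyMeasurable (𝓕⁻ Φ) volume := by
    have hcont : Continuous (𝓕⁻ Φ) := by
      rw [Real.fourierInv_eq_fourier_comp_neg]
      exact VectorFourier.fourierIntegral_continuous Real.continuous_fourierChar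
        (by exact continuous_inner) h1.comp_neg
    exact hcont.aestronglyMeasurable
  rw [e, eLpNorm_comp_measurePreserving hm (Measure.measurePreserving_neg volume)]
  exact eLpNorm_fourierInv_le h1 h2

/-! ### Plane waves -/

section Wave

variable (lam : Plane → ℝ)

lemma wave_mul_wave (t t' : ℝ) (x x' η : Plane) :
    wave lam t x η * wave lam t' x' η = wave lam (t + t') (x + x') η := by
  unfold wave
  rw [← Complex.exp_add, inner_add_left]
  congr 1
  push_cast; ring

lemma conj_wave (t : ℝ) (x η : Plane) :
    (starRingEnd ℂ) (wave lam t x η) = wave lam (-t) (-x) η := by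
  unfold wave
  rw [← Complex.exp_conj, map_mul, Complex.conj_I, Complex.conj_ofReal, inner_neg_left]
  congr 1
  push_cast; ring

variable {lam}

lemma measurable_wave {α : Type*} [MeasurableSpace α] (hlam : Measurable lam) {t : α → ℝ}
    {x η : α → Plane} (ht : Measurable t) (hx : Measurable x) (hη : Measurable η) :
    Measurable fun a => wave lam (t a) (x a) (η a) := by
  unfold wave
  have h2 : Measurable fun a => (2 * Real.pi * inner ℝ (x a) (η a) + t a * lam (η a) : ℝ) :=
    ((hx.inner (𝕜 := ℝ) hη).const_mul _).add (ht.mul (hlam.comp hη))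
  exact Complex.measurable_exp.comp ((Complex.measurable_ofReal.comp h2).const_mul _)

lemma continuous_wave (t : ℝ) (η : Plane) : Continuous fun x => wave lam t x η := by
  unfold wave
  fun_prop

/-- The solution at time `t` with frequency profile `Φ`, localised to the frequencies in `Ω`. -/
noncomputable def evol (lam : Plane → ℝ) (Ω : Set Plane) (t : ℝ) (Φ : Plane → ℂ) (x : Plane) : ℂ :=
  ∫ η in Ω, wave lam t x η * Φ η

variable {Ω : Set Plane}

lemma evol_eq_fourierInv (hΩ : MeasurableSet Ω) (t : ℝ) (Φ : Plane → ℂ) :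
    evol lam Ω t Φ = 𝓕⁻ (Ω.indicator fun η => wave lam t 0 η * Φ η) := by
  ext x
  rw [Real.fourierInv_eq', evol, ← integral_indicator hΩ]
  congr 1
  ext η
  by_cases h : η ∈ Ω
  · rw [Set.indicator_of_mem h, Set.indicator_of_mem h, smul_eq_mul, ← mul_assoc]
    have : Complex.exp (↑(2 * Real.pi * inner ℝ η x) * Complex.I) =
        wave lam 0 x η := by
      unfold wave
      rw [real_inner_comm, zero_mul, add_zero, mul_comm]
    rw [this, wave_mul_wave]; simp
  · simp [h]

lemma integrable_wave_mul (hlam : Measurable lam) {μ : Measure Plane} (t : ℝ) (x : Plane)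
    {Φ : Plane → ℂ} (hΦ : Integrable Φ μ) :
    Integrable (fun η => wave lam t x η * Φ η) μ :=
  hΦ.bdd_mul (c := 1) (measurable_wave hlam measurable_const measurable_const
    measurable_id).aestronglyMeasurable (ae_of_all _ fun _ => (norm_wave _ _ _ _).le)

lemma continuous_evol (hlam : Measurable lam) (t : ℝ) {Φ : Plane → ℂ}
    (hΦ : IntegrableOn Φ Ω) : Continuous (evol lam Ω t Φ) := by
  refine continuous_of_dominated (bound := fun η => ‖Φ η‖)
    (fun x => (integrable_wave_mul hlam t x hΦ).aestronglyMeasurable) (fun x => ae_of_all _ fun η => ?_)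
    hΦ.norm (ae_of_all _ fun η => (continuous_wave t η).mul continuous_const)
  rw [norm_mul, norm_wave, one_mul]

lemma norm_evol_le (t : ℝ) (Φ : Plane → ℂ) (x : Plane) :
    ‖evol lam Ω t Φ x‖ ≤ ∫ η in Ω, ‖Φ η‖ := by
  refine (norm_integral_le_integral_norm _).trans (le_of_eq ?_)
  simp [norm_wave]

/-- Plancherel, since waves have modulus one. Finite volume of Ω makes L² profiles integrable, so
that the integral defining the evolution converges absolutely. -/
lemma eLpNorm_evol_le (hlam : Measurable lam) (hΩ : MeasurableSet Ω) (hΩv : volume Ω ≠ ⊤) (t : ℝ)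
    {Φ : Plane → ℂ} (hΦ : MemLp Φ 2 (volume.restrict Ω)) :
    eLpNorm (evol lam Ω t Φ) 2 volume ≤ eLpNorm Φ 2 (volume.restrict Ω) := by
  have : IsFiniteMeasure (volume.restrict Ω) := isFiniteMeasure_restrict.2 hΩv
  have hmeas : AEStronglyMeasurable (fun η => wave lam t 0 η * Φ η)
      (volume.restrict Ω) :=
    (measurable_wave hlam measurable_const measurable_const
      measurable_id).aestronglyMeasurable.mul hΦ.1
  have hn : eLpNorm (fun η => wave lam t 0 η * Φ η) 2 (volume.restrict Ω) =
      eLpNorm Φ 2 (volume.restrict Ω) :=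
    eLpNorm_congr_norm_ae (ae_of_all _ fun η => by rw [norm_mul, norm_wave, one_mul])
  have h2 : MemLp (fun η => wave lam t 0 η * Φ η) 2 (volume.restrict Ω) :=
    ⟨hmeas, by rw [hn]; exact hΦ.2⟩
  rw [evol_eq_fourierInv hΩ]
  refine (eLpNorm_fourierInv_le ?_ ?_).trans ?_
  · rw [integrable_indicator_iff hΩ]
    exact h2.integrable (by norm_num)
  · exact (memLp_indicator_iff_restrict hΩ).2 h2
  · rw [eLpNorm_indicator_eq_eLpNorm_restrict hΩ, hn]

end Wave

/-! ### Mixed norms -/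

/-- A bounded function `u` on the line lies in `L⁴` with norm at most `B` if it acts on bounded
functions of bounded support as a functional on `L^{4/3}` of norm at most `B`. -/
lemma lintegral_enorm_pow_four_le {u : ℝ → ℂ} (hu : Measurable u) {c : ℝ} (huc : ∀ t, ‖u t‖ ≤ c)
    (B : ℝ≥0∞)
    (H : ∀ h : ℝ → ℂ, Measurable h → Integrable h →
      ‖∫ t, h t * u t‖ₑ ≤ B * (∫⁻ t, ‖h t‖ₑ ^ (4 / 3 : ℝ)) ^ (3 / 4 : ℝ)) :
    ∫⁻ t, ‖u t‖ₑ ^ (4 : ℝ) ≤ B ^ (4 : ℝ) := by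
  refine lintegral_pow_four_le_of_forall_lintegral_mul_le hu.enorm B fun h N hh hN hsupp => ?_
  -- A measurable phase with σ(z)z = |z|; the value 1 at z = 0 keeps |σ| = 1 everywhere, so
  -- multiplying by it preserves the L^{4/3} norm.
  set σ : ℂ → ℂ := fun z => if z = 0 then 1 else (starRingEnd ℂ) z / ‖z‖ with hσ
  have hσm : Measurable σ := Measurable.ite (measurableSet_singleton 0) measurable_const
    ((Complex.continuous_conj.measurable).div
      (Complex.measurable_ofReal.comp measurable_norm))
  have hσn : ∀ z, ‖σ z‖ = 1 := fun z => by
    by_cases hz : z = 0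
    · simp [hσ, hz]
    · simp [hσ, hz]
  have hσz : ∀ z, σ z * z = (‖z‖ : ℂ) := fun z => by
    by_cases hz : z = 0
    · simp [hσ, hz]
    · have : (‖z‖ : ℂ) ≠ 0 := by exact_mod_cast norm_ne_zero_iff.2 hz
      simp only [hσ, hz, if_false]
      rw [div_mul_eq_mul_div, Complex.conj_mul']
      field_simp
  have hfin : ∀ t, h t ≠ ⊤ := fun t => ne_top_of_le_ne_top ENNReal.coe_ne_top (hN t)
  set k : ℝ → ℂ := fun t => ((h t).toReal : ℂ) * σ (u t) with hk
  have hkm : Measurable k :=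
    (Complex.measurable_ofReal.comp hh.ennreal_toReal).mul (hσm.comp hu)
  have hkn : ∀ t, ‖k t‖ = (h t).toReal := fun t => by
    simp [hk, hσn]
  have hke : ∀ t, ‖k t‖ₑ = h t := fun t => by
    rw [← ofReal_norm, hkn, ENNReal.ofReal_toReal (hfin t)]
  have hki : Integrable k := by
    refine ⟨hkm.aestronglyMeasurable, ?_⟩
    rw [hasFiniteIntegral_iff_enorm]
    simp_rw [hke]
    have hset : MeasurableSet (Set.Icc (-N : ℝ) N) := measurableSet_Icc
    calc ∫⁻ t, h t ≤ ∫⁻ t, (Set.Icc (-N : ℝ) N).indicator (fun _ => (N : ℝ≥0∞)) t := by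
          refine lintegral_mono fun t => ?_
          by_cases ht : t ∈ Set.Icc (-N : ℝ) N
          · rw [Set.indicator_of_mem ht]; exact hN t
          · rw [Set.indicator_of_notMem ht, hsupp t]
            rw [← not_le, abs_le]; exact ht
      _ < ⊤ := by
          rw [lintegral_indicator hset, setLIntegral_const, Real.volume_Icc]
          exact ENNReal.mul_lt_top ENNReal.coe_lt_top ENNReal.ofReal_lt_top
  have hkey := H k hkm hki
  simp_rw [hke] at hkey
  refine le_trans (le_of_eq ?_) hkey
  have hprod : ∀ t, k t * u t = (((h t).toReal * ‖u t‖ : ℝ) : ℂ) := fun t => by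
    simp only [hk]; rw [mul_assoc, hσz]; push_cast; rfl
  simp_rw [hprod]
  rw [integral_complex_ofReal, ← ofReal_norm, Complex.norm_real, Real.norm_of_nonneg
    (integral_nonneg fun t => by positivity), ofReal_integral_eq_lintegral_ofReal]
  · refine lintegral_congr fun t => ?_
    rw [ENNReal.ofReal_mul ENNReal.toReal_nonneg, ENNReal.ofReal_toReal (hfin t), ofReal_norm]
  · have : Integrable fun t => ‖k t‖ * ‖u t‖ :=
      hki.norm.mul_bdd (c := c) hu.norm.aestronglyMeasurable
        (ae_of_all _ fun t => by rw [norm_norm]; exact huc t)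
    simpa only [hkn] using this
  · exact ae_of_all _ fun t => by simp only [Pi.zero_apply]; positivity

/-- Linearisation of the maximal function `sup_x |u(t,x)|`. -/
lemma exists_measurable_bound_of_forall_section {u : ℝ → Plane → ℂ}
    (hu : Measurable (Function.uncurry u)) (hc : ∀ t, Continuous (u t)) {B : ℝ≥0∞}
    (H : ∀ X : ℝ → Plane, Measurable X → ∫⁻ t, ‖u t (X t)‖ₑ ^ (4 : ℝ) ≤ B) :
    ∃ M : ℝ → ℝ≥0∞, Measurable M ∧ (∀ t x, ‖u t x‖ₑ ≤ M t) ∧ ∫⁻ t, M t ^ (4 : ℝ) ≤ B := by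
  classical
  set d := TopologicalSpace.denseSeq Plane with hd
  have hcomp : ∀ X : ℝ → Plane, Measurable X → Measurable fun t => ‖u t (X t)‖ₑ := fun X hX =>
    (hu.comp (measurable_id.prodMk hX)).enorm
  -- X n selects measurably a maximiser of |u(t,·)| among the first n + 1 points of a dense
  -- sequence. The values increase with n, so monotone convergence passes the bound to the supremum.
  let X : ℕ → ℝ → Plane := fun n => Nat.rec (fun _ => d 0)
    (fun n Y t => if ‖u t (Y t)‖ₑ < ‖u t (d (n + 1))‖ₑ then d (n + 1) else Y t) n
  have hX0 : X 0 = fun _ => d 0 := rfl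
  have hXs : ∀ n, X (n + 1) =
      fun t => if ‖u t (X n t)‖ₑ < ‖u t (d (n + 1))‖ₑ then d (n + 1) else X n t := fun _ => rfl
  have hXm : ∀ n, Measurable (X n) := fun n => by
    induction n with
    | zero => rw [hX0]; exact measurable_const
    | succ n ih =>
      rw [hXs]
      exact Measurable.ite (measurableSet_lt (hcomp _ ih) (hcomp _ measurable_const))
        measurable_const ih
  have hstep : ∀ n t, ‖u t (X (n + 1) t)‖ₑ = max ‖u t (X n t)‖ₑ ‖u t (d (n + 1))‖ₑ := by
    intro n t
    rw [hXs]
    dsimp only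
    split_ifs with h
    · rw [max_eq_right h.le]
    · rw [max_eq_left (not_lt.1 h)]
  have hmono : ∀ t, Monotone fun n => ‖u t (X n t)‖ₑ := fun t =>
    monotone_nat_of_le_succ fun n => by rw [hstep]; exact le_max_left _ _
  have hdle : ∀ n t, ‖u t (d n)‖ₑ ≤ ‖u t (X n t)‖ₑ := fun n t => by
    cases n with
    | zero => rw [hX0]
    | succ n => rw [hstep]; exact le_max_right _ _
  refine ⟨fun t => ⨆ n, ‖u t (X n t)‖ₑ, Measurable.iSup fun n => hcomp _ (hXm n), fun t x => ?_, ?_⟩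
  · have hcl : IsClosed {x | ‖u t x‖ₑ ≤ ⨆ n, ‖u t (X n t)‖ₑ} :=
      isClosed_le (hc t).enorm continuous_const
    exact (TopologicalSpace.denseRange_denseSeq Plane).induction_on x hcl fun n =>
      (hdle n t).trans (le_iSup (fun n => ‖u t (X n t)‖ₑ) n)
  · have hsup : ∀ t, (⨆ n, ‖u t (X n t)‖ₑ) ^ (4 : ℝ) = ⨆ n, ‖u t (X n t)‖ₑ ^ (4 : ℝ) := fun t => by
      exact (ENNReal.orderIsoRpow 4 (by norm_num)).map_iSup fun n => ‖u t (X n t)‖ₑ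
    simp_rw [hsup]
    rw [lintegral_iSup (fun n => (hcomp _ (hXm n)).pow_const _)
      fun m n hmn t => ENNReal.rpow_le_rpow (hmono t hmn) (by norm_num)]
    exact iSup_le fun n => H _ (hXm n)

/-- The interpolation parameter `4/q` of an admissible pair. -/
noncomputable def admissibleExponent (q : ℝ≥0∞) : ℝ := 4 * (1 / q).toReal

/-- With θ = 4/q, admissibility says that (1/q, 1/r) is the convex combination of (0, 1/2) and (1/4,
0) with weights 1 - θ and θ. -/
lemma HalfAdmissible.one_div_eq {q r : ℝ≥0∞} (h : HalfAdmissible q r) :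
    (1 / r).toReal = (1 - admissibleExponent q) / 2 := by
  have hs := h.scaling
  have hr0 : r ≠ 0 := (lt_of_lt_of_le (by norm_num) h.two_le).ne'
  have hq0 : q ≠ 0 := (lt_of_lt_of_le (by norm_num) h.four_le).ne'
  have h1 := congrArg ENNReal.toReal hs
  rw [ENNReal.toReal_add (by simp [hq0]) (by simp [hr0])] at h1
  unfold admissibleExponent
  simp only [one_div, ENNReal.toReal_inv, ENNReal.toReal_mul] at h1 ⊢
  norm_num at h1
  linarith

lemma admissibleExponent_nonneg (q : ℝ≥0∞) : 0 ≤ admissibleExponent q := by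
  unfold admissibleExponent; positivity

lemma HalfAdmissible.exponent_le_one {q r : ℝ≥0∞} (h : HalfAdmissible q r) :
    admissibleExponent q ≤ 1 := by
  have := h.one_div_eq
  have : 0 ≤ (1 / r).toReal := ENNReal.toReal_nonneg
  linarith

lemma admissibleExponent_eq_div {q : ℝ≥0∞} : admissibleExponent q = 4 / q.toReal := by
  simp [admissibleExponent, div_eq_mul_inv]

/-- |g|^r ≤ M^{r-2}|g|² pointwise, and (r - 2)/r = θ, 2/r = 1 - θ. -/
lemma HalfAdmissible.eLpNorm_le {q r : ℝ≥0∞} (h : HalfAdmissible q r) {g : Plane → ℂ}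
    (hg : AEStronglyMeasurable g volume) {a M : ℝ≥0∞} (ha : eLpNorm g 2 volume ≤ a)
    (hM : ∀ x, ‖g x‖ₑ ≤ M) :
    eLpNorm g r volume ≤ a ^ (1 - admissibleExponent q) * M ^ admissibleExponent q := by
  have hrel := h.one_div_eq
  have hr0 : r ≠ 0 := (lt_of_lt_of_le (by norm_num) h.two_le).ne'
  rcases eq_or_ne r ⊤ with rfl | hr
  · have hθ : admissibleExponent q = 1 := by simp at hrel; linarith
    rw [hθ, sub_self, ENNReal.rpow_zero, one_mul, ENNReal.rpow_one, eLpNorm_exponent_top]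
    exact essSup_le_of_ae_le _ (ae_of_all _ hM)
  set θ := admissibleExponent q with hθ
  set ρ := r.toReal with hρ
  have hρ2 : 2 ≤ ρ := by
    have := ENNReal.toReal_mono hr h.two_le
    simpa using this
  have hrel' : 1 / ρ = (1 - θ) / 2 := by
    rw [← hrel]; simp [hρ]
  have ha' : (∫⁻ x, ‖g x‖ₑ ^ (2 : ℝ)) ≤ a ^ (2 : ℝ) := by
    rw [eLpNorm_eq_lintegral_rpow_enorm_toReal (by norm_num) (by norm_num)] at ha
    have := ENNReal.rpow_le_rpow ha (show (0 : ℝ) ≤ 2 by norm_num)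
    rw [← ENNReal.rpow_mul] at this
    simpa using this
  rw [eLpNorm_eq_lintegral_rpow_enorm_toReal hr0 hr]
  calc (∫⁻ x, ‖g x‖ₑ ^ ρ) ^ (1 / ρ) ≤ (∫⁻ x, M ^ (ρ - 2) * ‖g x‖ₑ ^ (2 : ℝ)) ^ (1 / ρ) := by
        gcongr with x
        calc ‖g x‖ₑ ^ ρ = ‖g x‖ₑ ^ (ρ - 2) * ‖g x‖ₑ ^ (2 : ℝ) := by
              rw [← ENNReal.rpow_add_of_nonneg _ _ (by linarith) (by norm_num)]; ring_nf
          _ ≤ _ := by gcongr; exact hM x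
    _ ≤ (M ^ (ρ - 2) * a ^ (2 : ℝ)) ^ (1 / ρ) := by
        rw [lintegral_const_mul'' _ (hg.enorm.pow_const _)]
        gcongr
    _ = a ^ (1 - θ) * M ^ θ := by
        rw [ENNReal.mul_rpow_of_nonneg _ _ (by positivity), ← ENNReal.rpow_mul,
          ← ENNReal.rpow_mul, mul_comm]
        have e1 : 2 * (1 / ρ) = 1 - θ := by rw [hrel']; ring
        have e2 : (ρ - 2) * (1 / ρ) = θ := by
          have : (ρ - 2) * (1 / ρ) = 1 - 2 * (1 / ρ) := by field_simp
          rw [this, e1]; ring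
        rw [e1, e2]

/-- Because θq = 4, the q-th power of M^θ is M⁴. At q = ∞ one has θ = 0 and M disappears. -/
lemma HalfAdmissible.eLpNorm_rpow_le {q r : ℝ≥0∞} (h : HalfAdmissible q r) {M : ℝ → ℝ≥0∞}
    (hM : Measurable M) {a b : ℝ≥0∞} (hb : ∫⁻ t, M t ^ (4 : ℝ) ≤ b ^ (4 : ℝ)) :
    eLpNorm (fun t => a ^ (1 - admissibleExponent q) * M t ^ admissibleExponent q) q volume ≤
      a ^ (1 - admissibleExponent q) * b ^ admissibleExponent q := by
  have hq0 : q ≠ 0 := (lt_of_lt_of_le (by norm_num) h.four_le).ne'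
  rcases eq_or_ne q ⊤ with rfl | hq
  · have hθ : admissibleExponent ⊤ = 0 := by simp [admissibleExponent]
    rw [hθ]
    simp only [ENNReal.rpow_zero, mul_one, eLpNorm_exponent_top]
    exact essSup_le_of_ae_le _ (ae_of_all _ fun t => by simp)
  have hqpos : 0 < q.toReal := ENNReal.toReal_pos hq0 hq
  have hqθ : admissibleExponent q * q.toReal = 4 := by
    rw [admissibleExponent_eq_div]; field_simp
  rw [eLpNorm_eq_lintegral_rpow_enorm_toReal hq0 hq]
  simp only [enorm_eq_self]
  simp_rw [ENNReal.mul_rpow_of_nonneg _ _ hqpos.le, ← ENNReal.rpow_mul _ _ q.toReal, hqθ]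
  rw [lintegral_const_mul _ (by fun_prop)]
  calc _ ≤ (a ^ ((1 - admissibleExponent q) * q.toReal) * b ^ (4 : ℝ)) ^ (1 / q.toReal) := by gcongr
    _ = _ := by
        rw [ENNReal.mul_rpow_of_nonneg _ _ (by positivity), ← ENNReal.rpow_mul, ← ENNReal.rpow_mul,
          admissibleExponent_eq_div]
        congr 2 <;> field_simp

/-- Interpolation between `L^∞ L²` and `L⁴ L^∞`. -/
theorem HalfAdmissible.mixedNorm_le {q r : ℝ≥0∞} (h : HalfAdmissible q r) {G : ℝ → Plane → ℂ}
    (hG : ∀ t, AEStronglyMeasurable (G t) volume) {M : ℝ → ℝ≥0∞} (hM : Measurable M) {a b : ℝ≥0∞}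
    (ha : ∀ t, eLpNorm (G t) 2 volume ≤ a) (hGM : ∀ t x, ‖G t x‖ₑ ≤ M t)
    (hb : ∫⁻ t, M t ^ (4 : ℝ) ≤ b ^ (4 : ℝ)) :
    mixedNorm q r G ≤ a ^ (1 - admissibleExponent q) * b ^ admissibleExponent q := by
  refine le_trans ?_ (h.eLpNorm_rpow_le hM hb)
  refine eLpNorm_mono_enorm fun t => ?_
  simp only [enorm_eq_self]
  exact h.eLpNorm_le (hG t) (ha t) (hGM t)

/-- Hölder's inequality for mixed norms, the second factor being controlled in `L^∞ L²` and in
`L⁴ L^∞`. -/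
theorem HalfAdmissible.lintegral_mul_le {q r q' r' : ℝ≥0∞} (h : HalfAdmissible q r)
    (hq : 1 / q + 1 / q' = 1) (hr : 1 / r + 1 / r' = 1) {F G : ℝ → Plane → ℂ}
    (hF : Measurable (Function.uncurry F))
    (hG : ∀ t, AEStronglyMeasurable (G t) volume) {M : ℝ → ℝ≥0∞} (hM : Measurable M) {a b : ℝ≥0∞}
    (ha : ∀ t, eLpNorm (G t) 2 volume ≤ a) (hGM : ∀ t x, ‖G t x‖ₑ ≤ M t)
    (hb : ∫⁻ t, M t ^ (4 : ℝ) ≤ b ^ (4 : ℝ)) :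
    ∫⁻ t, ∫⁻ x, ‖F t x‖ₑ * ‖G t x‖ₑ ≤
      mixedNorm q' r' F * (a ^ (1 - admissibleExponent q) * b ^ admissibleExponent q) := by
  set m : ℝ → ℝ≥0∞ := fun t => a ^ (1 - admissibleExponent q) * M t ^ admissibleExponent q with hm
  have hmm : Measurable m := by fun_prop
  have hr0 : r ≠ 0 := (lt_of_lt_of_le (by norm_num) h.two_le).ne'
  have hq0 : q ≠ 0 := (lt_of_lt_of_le (by norm_num) h.four_le).ne'
  simp only [one_div] at hq hr
  -- r ≥ 2 and q ≥ 4 force finite dual exponents, so the norms on that side are integrals and the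
  -- inner one is measurable in t.
  have hr't : r' ≠ ⊤ := by
    rintro rfl
    have : r = 1 := by simpa using hr
    have h2 := h.two_le
    rw [this] at h2
    exact absurd h2 (by norm_num)
  have hr'0 : r' ≠ 0 := by rintro rfl; simp at hr
  have hq't : q' ≠ ⊤ := by
    rintro rfl
    have : q = 1 := by simpa using hq
    have h2 := h.four_le
    rw [this] at h2
    exact absurd h2 (by norm_num)
  have hq'0 : q' ≠ 0 := by rintro rfl; simp at hq
  have : ENNReal.HolderTriple r' r 1 := ⟨by rw [add_comm, hr, inv_one]⟩
  have hFn : Measurable fun t => eLpNorm (F t) r' volume := by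
    simp_rw [eLpNorm_eq_lintegral_rpow_enorm_toReal hr'0 hr't]
    exact ((hF.enorm.pow_const _).lintegral_prod_right').pow_const _
  have hinner : ∀ t, ∫⁻ x, ‖F t x‖ₑ * ‖G t x‖ₑ ≤ eLpNorm (F t) r' volume * m t := fun t => by
    have hFt : AEStronglyMeasurable (F t) volume :=
      (hF.comp measurable_prodMk_left).aestronglyMeasurable
    calc ∫⁻ x, ‖F t x‖ₑ * ‖G t x‖ₑ = eLpNorm (F t • G t) 1 volume := by
          rw [eLpNorm_one_eq_lintegral_enorm]
          exact lintegral_congr fun x => (enorm_mul _ _).symm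
      _ ≤ eLpNorm (F t) r' volume * eLpNorm (G t) r volume := eLpNorm_smul_le_mul_eLpNorm (hG t) hFt
      _ ≤ _ := by gcongr; exact h.eLpNorm_le (hG t) (ha t) (hGM t)
  refine (lintegral_mono hinner).trans ?_
  have hmn : eLpNorm m q volume ≤ _ := h.eLpNorm_rpow_le (a := a) hM hb
  refine le_trans ?_ (mul_le_mul_right hmn _)
  unfold mixedNorm
  rcases eq_or_ne q ⊤ with rfl | hqt
  · have hq'1 : q' = 1 := by simpa using hq
    rw [hq'1, eLpNorm_one_eq_lintegral_enorm, eLpNorm_exponent_top]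
    simp only [enorm_eq_self]
    calc _ ≤ ∫⁻ t, eLpNorm (F t) r' volume * eLpNormEssSup m volume := by
          refine lintegral_mono_ae ?_
          filter_upwards [enorm_ae_le_eLpNormEssSup m volume] with t ht
          simp only [enorm_eq_self] at ht
          gcongr
      _ = _ := lintegral_mul_const _ hFn
  · have hconj : q'.toReal.HolderConjugate q.toReal := by
      have h1 := congrArg ENNReal.toReal hq
      rw [ENNReal.toReal_add (by simp [hq0]) (by simp [hq'0]), ENNReal.toReal_inv,
        ENNReal.toReal_inv, ENNReal.toReal_one] at h1
      have p1 := ENNReal.toReal_pos hq0 hqt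
      have p2 := ENNReal.toReal_pos hq'0 hq't
      exact Real.holderConjugate_iff.2 ⟨by
        have : q'.toReal⁻¹ < 1 := by have := inv_pos.2 p1; linarith
        exact (inv_lt_one₀ p2).1 this, by linarith⟩
    rw [eLpNorm_eq_lintegral_rpow_enorm_toReal hq'0 hq't, eLpNorm_eq_lintegral_rpow_enorm_toReal hq0 hqt]
    simp only [enorm_eq_self]
    exact ENNReal.lintegral_mul_le_Lp_mul_Lq _ hconj hFn.aemeasurable hmm.aemeasurable

/-! ### Abstract Strichartz estimates for a localised dispersive group -/

lemma eLpNorm_two_rpow {α : Type*} [MeasurableSpace α] (μ : Measure α) (f : α → ℂ) :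
    eLpNorm f 2 μ ^ (2 : ℝ) = ∫⁻ x, ‖f x‖ₑ ^ (2 : ℝ) ∂μ := by
  rw [eLpNorm_eq_lintegral_rpow_enorm_toReal (by norm_num) (by norm_num), ← ENNReal.rpow_mul]
  simp

/-- Writing the squared norm as an integral of a product, without absolute values, allows it to be
expanded and reordered by Fubini in the `TT*` arguments. -/
lemma eLpNorm_two_rpow_eq_enorm_integral {α : Type*} [MeasurableSpace α] {μ : Measure α}
    {f : α → ℂ} (hf : MemLp f 2 μ) :
    eLpNorm f 2 μ ^ (2 : ℝ) = ‖∫ x, f x * (starRingEnd ℂ) (f x) ∂μ‖ₑ := by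
  have h1 : ∀ x, f x * (starRingEnd ℂ) (f x) = ((‖f x‖ ^ 2 : ℝ) : ℂ) := fun x => by
    rw [Complex.mul_conj']; push_cast; rfl
  simp_rw [h1]
  rw [integral_complex_ofReal, ← ofReal_norm, Complex.norm_real, Real.norm_of_nonneg
    (integral_nonneg fun t => by positivity), ofReal_integral_eq_lintegral_ofReal,
    eLpNorm_two_rpow]
  · refine lintegral_congr fun x => ?_
    rw [ENNReal.ofReal_pow (norm_nonneg _), ofReal_norm]
    norm_cast
  · exact hf.integrable_norm_pow (by norm_num)
  · exact ae_of_all _ fun t => by simp only [Pi.zero_apply]; positivity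

lemma integrable_prod_of_norm_le {α β : Type*} [MeasurableSpace α] [MeasurableSpace β]
    {μ : Measure α} [IsFiniteMeasure μ] {ν : Measure β} [SFinite ν] {f : α × β → ℂ}
    (hf : Measurable f) {g : β → ℝ} (hg : Integrable g ν) (h : ∀ a b, ‖f (a, b)‖ ≤ g b) :
    Integrable f (μ.prod ν) :=
  (hg.comp_snd μ).mono' hf.aestronglyMeasurable (ae_of_all _ fun p => h p.1 p.2)

/-- The norm of `L^{4/3}(ℝ)`. -/
noncomputable def normFourThirds (h : ℝ → ℂ) : ℝ≥0∞ := (∫⁻ t, ‖h t‖ₑ ^ (4 / 3 : ℝ)) ^ (3 / 4 : ℝ)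

/-- At time 0 a wave does not involve the symbol, so any λ may be inserted. -/
lemma fourier_indicator_eq {Ω : Set Plane} (hΩ : MeasurableSet Ω) (lam : Plane → ℝ)
    (Ψ : Plane → ℂ) (y : Plane) :
    𝓕 (Ω.indicator Ψ) y = ∫ η in Ω, wave lam 0 (-y) η * Ψ η := by
  rw [Real.fourier_eq', ← integral_indicator hΩ]
  congr 1
  ext η
  by_cases h : η ∈ Ω
  · rw [Set.indicator_of_mem h, Set.indicator_of_mem h, smul_eq_mul]
    congr 1
    unfold wave
    rw [real_inner_comm, inner_neg_left, zero_mul, add_zero, mul_comm]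
    congr 3; ring
  · simp [h]

lemma continuous_fourier_of_integrable {f : Plane → ℂ} (hf : Integrable f) : Continuous (𝓕 f) :=
  VectorFourier.fourierIntegral_continuous Real.continuous_fourierChar
    (by exact continuous_inner) hf

lemma measurable_fourier_comp {G : ℝ → Plane → ℂ} (hG : Measurable (Function.uncurry G))
    {α : Type*} [MeasurableSpace α] {s : α → ℝ} {η : α → Plane} (hs : Measurable s)
    (hη : Measurable η) : Measurable fun a => 𝓕 (G (s a)) (η a) := by
  simp_rw [Real.fourier_eq', smul_eq_mul]
  have : Measurable fun z : α × Plane =>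
      Complex.exp ((↑(-2 * Real.pi * inner ℝ z.2 (η z.1)) * Complex.I)) * G (s z.1) z.2 := by
    refine Measurable.mul ?_ (hG.comp ((hs.comp measurable_fst).prodMk measurable_snd))
    exact Complex.measurable_exp.comp ((Complex.measurable_ofReal.comp
      ((measurable_snd.inner (𝕜 := ℝ) (hη.comp measurable_fst)).const_mul _)).mul_const _)
  exact this.stronglyMeasurable.integral_prod_right'.measurable

/-- A dispersive group localised to a set of frequencies of finite measure: the kernel decays like
`|t|^{-1/2}`, with a constant `A` controlled by `D²`. -/
structure DispersiveGroup (lam : Plane → ℝ) (Ω : Set Plane) (A D : ℝ≥0∞) : Prop where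
  measurable_symbol : Measurable lam
  measurableSet : MeasurableSet Ω
  volume_ne_top : volume Ω ≠ ⊤
  kernel_le : ∀ t x, ‖∫ η in Ω, wave lam t x η‖ₑ ≤ A * rieszKernel t
  -- 12 is the Hardy–Littlewood–Sobolev constant: D² bounds the norm of `TT*`, D that of `T`.
  const_le : 12 * A ≤ D ^ (2 : ℝ)

namespace DispersiveGroup

variable {lam : Plane → ℝ} {Ω : Set Plane} {A D : ℝ≥0∞}

lemma isFiniteMeasure (hD : DispersiveGroup lam Ω A D) : IsFiniteMeasure (volume.restrict Ω) :=
  isFiniteMeasure_restrict.2 hD.volume_ne_top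

lemma measurable_packet (hD : DispersiveGroup lam Ω A D) {X : ℝ → Plane} (hX : Measurable X)
    {h : ℝ → ℂ} (hh : Measurable h) :
    Measurable fun η => ∫ t, h t * wave lam t (X t) η := by
  have : Measurable fun p : Plane × ℝ => h p.2 * wave lam p.2 (X p.2) p.1 :=
    (hh.comp measurable_snd).mul (measurable_wave hD.measurable_symbol measurable_snd
      (hX.comp measurable_snd) measurable_fst)
  exact this.stronglyMeasurable.integral_prod_right'.measurable

lemma memLp_packet (hD : DispersiveGroup lam Ω A D) {X : ℝ → Plane} (hX : Measurable X)
    {h : ℝ → ℂ} (hh : Measurable h) (p : ℝ≥0∞) :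
    MemLp (fun η => ∫ t, h t * wave lam t (X t) η) p (volume.restrict Ω) := by
  have := hD.isFiniteMeasure
  refine MemLp.of_bound (hD.measurable_packet hX hh).aestronglyMeasurable (∫ t, ‖h t‖)
    (ae_of_all _ fun η => (norm_integral_le_integral_norm _).trans (le_of_eq ?_))
  simp [norm_wave]

/-- Superpositions of waves emanating from the points of a measurable curve. -/
theorem eLpNorm_packet_le (hD : DispersiveGroup lam Ω A D) {X : ℝ → Plane} (hX : Measurable X)
    {h : ℝ → ℂ} (hh : Measurable h) (hi : Integrable h) :
    eLpNorm (fun η => ∫ t, h t * wave lam t (X t) η) 2 (volume.restrict Ω) ≤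
      D * normFourThirds h := by
  have := hD.isFiniteMeasure
  set V : Plane → ℂ := fun η => ∫ t, h t * wave lam t (X t) η with hV
  set f : Plane × (ℝ × ℝ) → ℂ := fun z => h z.2.1 * (starRingEnd ℂ) (h z.2.2) *
    wave lam (z.2.1 - z.2.2) (X z.2.1 - X z.2.2) z.1 with hf
  have hfm : Measurable f := by
    refine Measurable.mul ?_ (measurable_wave hD.measurable_symbol (by fun_prop) (by fun_prop)
      (by fun_prop))
    exact (by fun_prop : Measurable fun z : Plane × (ℝ × ℝ) => h z.2.1).mul
      (Complex.continuous_conj.measurable.comp (by fun_prop))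
  -- `TT*`: |V|² is a double time integral of waves. Integrating over Ω first produces the
  -- dispersive kernel at (s - t, X(s) - X(t)), bounded uniformly in the curve.
  have hVV : ∀ η, V η * (starRingEnd ℂ) (V η) = ∫ p : ℝ × ℝ, f (η, p) ∂(volume.prod volume) := by
    intro η
    simp only [hV]
    rw [← integral_conj, ← integral_prod_mul]
    refine integral_congr_ae (ae_of_all _ fun p => ?_)
    simp only [hf, map_mul, conj_wave]
    rw [sub_eq_add_neg p.1 p.2, sub_eq_add_neg (X p.1) (X p.2), ← wave_mul_wave]
    ring
  have hfi : Integrable f ((volume.restrict Ω).prod (volume.prod volume)) := by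
    refine integrable_prod_of_norm_le hfm (g := fun p : ℝ × ℝ => ‖h p.1‖ * ‖h p.2‖)
      (hi.norm.mul_prod hi.norm) fun η p => ?_
    simp only [hf, norm_mul, norm_wave, mul_one, RCLike.norm_conj]
    exact le_rfl
  have key : eLpNorm V 2 (volume.restrict Ω) ^ (2 : ℝ) ≤ (D * normFourThirds h) ^ (2 : ℝ) := by
    rw [eLpNorm_two_rpow_eq_enorm_integral (hD.memLp_packet hX hh 2)]
    calc ‖∫ η in Ω, V η * (starRingEnd ℂ) (V η)‖ₑ
        = ‖∫ p : ℝ × ℝ, (∫ η in Ω, f (η, p)) ∂(volume.prod volume)‖ₑ := by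
          simp_rw [hVV]
          rw [integral_integral_swap (f := fun η p => f (η, p)) hfi]
      _ ≤ ∫⁻ p : ℝ × ℝ, ‖∫ η in Ω, f (η, p)‖ₑ ∂(volume.prod volume) :=
          enorm_integral_le_lintegral_enorm _
      _ ≤ ∫⁻ p : ℝ × ℝ, A * (‖h p.1‖ₑ * ‖h p.2‖ₑ * rieszKernel (p.2 - p.1)) ∂(volume.prod volume) := by
          refine lintegral_mono fun p => ?_
          simp only [hf]
          rw [integral_const_mul, enorm_mul, enorm_mul, rieszKernel_sub_comm]
          calc _ ≤ ‖h p.1‖ₑ * ‖(starRingEnd ℂ) (h p.2)‖ₑ * (A * rieszKernel (p.1 - p.2)) := by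
                gcongr; exact hD.kernel_le _ _
            _ = A * (‖h p.1‖ₑ * ‖h p.2‖ₑ * rieszKernel (p.1 - p.2)) := by
                rw [← ofReal_norm ((starRingEnd ℂ) (h p.2)), RCLike.norm_conj, ofReal_norm]
                ring
      _ = A * ∫⁻ s, ∫⁻ t, ‖h s‖ₑ * ‖h t‖ₑ * rieszKernel (t - s) := by
          have hm : Measurable fun p : ℝ × ℝ => ‖h p.1‖ₑ * ‖h p.2‖ₑ * rieszKernel (p.2 - p.1) :=
            ((hh.enorm.comp measurable_fst).mul (hh.enorm.comp measurable_snd)).mul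
              (measurable_rieszKernel.comp (measurable_snd.sub measurable_fst))
          rw [lintegral_const_mul _ hm, lintegral_prod _ hm.aemeasurable]
      _ ≤ A * (12 * normFourThirds h * normFourThirds h) := by
          gcongr
          exact lintegral_lintegral_rieszKernel_le hh.enorm hh.enorm
      _ = 12 * A * normFourThirds h ^ (2 : ℝ) := by
          rw [show (2 : ℝ) = ((2 : ℕ) : ℝ) by norm_num, ENNReal.rpow_natCast]; ring
      _ ≤ D ^ (2 : ℝ) * normFourThirds h ^ (2 : ℝ) := by gcongr; exact hD.const_le
      _ = _ := (ENNReal.mul_rpow_of_nonneg _ _ (by norm_num)).symm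
  exact (ENNReal.rpow_le_rpow_iff (by norm_num)).1 key

lemma measurable_evol (hD : DispersiveGroup lam Ω A D) {Φ : ℝ → Plane → ℂ}
    (hΦ : Measurable (Function.uncurry Φ)) :
    Measurable (Function.uncurry fun t x => evol lam Ω t (Φ t) x) := by
  have : Measurable fun z : (ℝ × Plane) × Plane =>
      wave lam z.1.1 z.1.2 z.2 * Φ z.1.1 z.2 :=
    (measurable_wave hD.measurable_symbol (by fun_prop) (by fun_prop) (by fun_prop)).mul
      (hΦ.comp ((measurable_fst.comp measurable_fst).prodMk measurable_snd))
  exact this.stronglyMeasurable.integral_prod_right'.measurable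

lemma lintegral_enorm_mul_le_eLpNorm_two {α : Type*} [MeasurableSpace α] {μ : Measure α}
    {f g : α → ℂ} (hf : AEStronglyMeasurable f μ) (hg : AEStronglyMeasurable g μ) :
    ∫⁻ x, ‖f x * g x‖ₑ ∂μ ≤ eLpNorm f 2 μ * eLpNorm g 2 μ := by
  rw [← eLpNorm_one_eq_lintegral_enorm]
  have e : (fun x => f x * g x) = f • g := rfl
  rw [e]
  exact eLpNorm_smul_le_mul_eLpNorm hg hf

/-- The endpoint `L⁴ L^∞` estimate for the free evolution. -/
theorem exists_bound_evol (hD : DispersiveGroup lam Ω A D) {Φ : Plane → ℂ} (hΦ : Measurable Φ)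
    (hΦ2 : MemLp Φ 2 (volume.restrict Ω)) :
    ∃ M : ℝ → ℝ≥0∞, Measurable M ∧ (∀ t x, ‖evol lam Ω t Φ x‖ₑ ≤ M t) ∧
      ∫⁻ t, M t ^ (4 : ℝ) ≤ (D * eLpNorm Φ 2 (volume.restrict Ω)) ^ (4 : ℝ) := by
  have := hD.isFiniteMeasure
  have hΦ1 : Integrable Φ (volume.restrict Ω) := hΦ2.integrable (by norm_num)
  have hum := hD.measurable_evol (Φ := fun _ => Φ) (hΦ.comp measurable_snd)
  -- Linearise the supremum along a curve and dualise in time; after Fubini the pairing is that of Φ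
  -- with a wave packet.
  refine exists_measurable_bound_of_forall_section hum
    (fun t => continuous_evol hD.measurable_symbol t hΦ1) fun X hX => ?_
  refine lintegral_enorm_pow_four_le (hum.comp (measurable_id.prodMk hX))
    (fun t => norm_evol_le t Φ (X t)) _ fun h hh hi => ?_
  set f : ℝ → Plane → ℂ := fun t η => h t * (wave lam t (X t) η * Φ η) with hf
  have hfm : Measurable (Function.uncurry f) :=
    (hh.comp measurable_fst).mul ((measurable_wave hD.measurable_symbol measurable_fst
      (hX.comp measurable_fst) measurable_snd).mul (hΦ.comp measurable_snd))
  have hfi : Integrable (Function.uncurry f) (volume.prod (volume.restrict Ω)) := by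
    refine (hi.norm.mul_prod hΦ1.norm).mono' hfm.aestronglyMeasurable (ae_of_all _ fun p => ?_)
    simp [hf, Function.uncurry, norm_wave]
  calc ‖∫ t, h t * evol lam Ω t Φ (X t)‖ₑ
      = ‖∫ η in Ω, Φ η * ∫ t, h t * wave lam t (X t) η‖ₑ := by
        simp_rw [evol, ← integral_const_mul]
        rw [integral_integral_swap (f := f) hfi]
        congr 2
        ext η
        congr 1
        ext t
        simp only [hf]; ring
    _ ≤ eLpNorm Φ 2 (volume.restrict Ω) * (D * normFourThirds h) := by
        refine (enorm_integral_le_lintegral_enorm _).trans ?_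
        refine (lintegral_enorm_mul_le_eLpNorm_two hΦ2.1 (hD.memLp_packet hX hh 2).1).trans ?_
        gcongr
        exact hD.eLpNorm_packet_le hX hh hi
    _ = _ := by rw [normFourThirds]; ring

/-- Recombines the two ends of the interpolation when the L⁴L^∞ bound is D times the L^∞L² bound. -/
lemma rpow_one_sub_mul_mul_rpow (a D : ℝ≥0∞) {θ : ℝ} (h0 : 0 ≤ θ) (h1 : θ ≤ 1) :
    a ^ (1 - θ) * (D * a) ^ θ = D ^ θ * a := by
  rw [ENNReal.mul_rpow_of_nonneg _ _ h0, mul_left_comm,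
    ← ENNReal.rpow_add_of_nonneg _ _ (by linarith) h0]
  simp

/-- **Homogeneous Strichartz estimate.** -/
theorem mixedNorm_evol_le (hD : DispersiveGroup lam Ω A D) {q r : ℝ≥0∞} (h : HalfAdmissible q r)
    {Φ : Plane → ℂ} (hΦ : Measurable Φ) (hΦ2 : MemLp Φ 2 (volume.restrict Ω)) :
    mixedNorm q r (fun t => evol lam Ω t Φ) ≤
      D ^ admissibleExponent q * eLpNorm Φ 2 (volume.restrict Ω) := by
  have := hD.isFiniteMeasure
  have hΦ1 : Integrable Φ (volume.restrict Ω) := hΦ2.integrable (by norm_num)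
  obtain ⟨M, hM, hGM, hb⟩ := hD.exists_bound_evol hΦ hΦ2
  refine (h.mixedNorm_le
    (fun t => (continuous_evol hD.measurable_symbol t hΦ1).aestronglyMeasurable) hM
    (fun t => eLpNorm_evol_le hD.measurable_symbol hD.measurableSet hD.volume_ne_top t hΦ2)
    hGM hb).trans (le_of_eq ?_)
  exact rpow_one_sub_mul_mul_rpow _ _ (admissibleExponent_nonneg q) h.exponent_le_one

/-- Pairing a space-time function, on the frequency side, with a function which is controlled in
`L^∞ L²` and in `L⁴ L^∞`. -/
lemma enorm_integral_fourier_mul_le (hD : DispersiveGroup lam Ω A D) {q r q' r' : ℝ≥0∞}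
    (h : HalfAdmissible q r) (hq : 1 / q + 1 / q' = 1) (hr : 1 / r + 1 / r' = 1)
    {G : ℝ → Plane → ℂ} (hG : Measurable (Function.uncurry G)) (hGi : ∀ s, Integrable (G s))
    {Ψ : ℝ → Plane → ℂ} (hΨ : ∀ s, MemLp (Ψ s) 2 (volume.restrict Ω)) {a b : ℝ≥0∞}
    (ha : ∀ s, eLpNorm (Ψ s) 2 (volume.restrict Ω) ≤ a) {M : ℝ → ℝ≥0∞} (hM : Measurable M)
    (hΨM : ∀ s y, ‖∫ η in Ω, wave lam 0 (-y) η * Ψ s η‖ₑ ≤ M s)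
    (hb : ∫⁻ t, M t ^ (4 : ℝ) ≤ b ^ (4 : ℝ)) :
    ‖∫ s, ∫ η in Ω, 𝓕 (G s) η * Ψ s η‖ₑ ≤
      mixedNorm q' r' G * (a ^ (1 - admissibleExponent q) * b ^ admissibleExponent q) := by
  have := hD.isFiniteMeasure
  have h1 : ∀ s, Integrable (Ω.indicator (Ψ s)) := fun s => by
    rw [integrable_indicator_iff hD.measurableSet]
    exact (hΨ s).integrable (by norm_num)
  have h2 : ∀ s, MemLp (Ω.indicator (Ψ s)) 2 volume := fun s =>
    (memLp_indicator_iff_restrict hD.measurableSet).2 (hΨ s)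
  set W : ℝ → Plane → ℂ := fun s => 𝓕 (Ω.indicator (Ψ s)) with hW
  -- The multiplication formula moves the Fourier transform from G onto the localised Ψ, so that
  -- Hölder applies in physical space.
  have hflip : ∀ s, ∫ η in Ω, 𝓕 (G s) η * Ψ s η = ∫ y, G s y * W s y := fun s => by
    have hsw := VectorFourier.integral_fourierIntegral_smul_eq_flip (μ := volume) (ν := volume)
      (L := innerₗ Plane) (f := G s) (g := Ω.indicator (Ψ s)) Real.continuous_fourierChar
      (continuous_inner (𝕜 := ℝ) (E := Plane)) (hGi s) (h1 s)
    have a2 : (innerₗ Plane).flip = innerₗ Plane := by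
      ext u v; simp
    rw [a2] at hsw
    refine Eq.trans ?_ hsw
    rw [← integral_indicator hD.measurableSet]
    congr 1
    ext η
    by_cases hη : η ∈ Ω
    · rw [Set.indicator_of_mem hη, Set.indicator_of_mem hη]; rfl
    · rw [Set.indicator_of_notMem hη, Set.indicator_of_notMem hη, smul_zero]
  calc _ ≤ ∫⁻ s, ∫⁻ y, ‖G s y‖ₑ * ‖W s y‖ₑ := by
        refine (enorm_integral_le_lintegral_enorm _).trans (lintegral_mono fun s => ?_)
        rw [hflip]
        refine (enorm_integral_le_lintegral_enorm _).trans (le_of_eq ?_)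
        exact lintegral_congr fun y => enorm_mul _ _
    _ ≤ _ := by
        refine h.lintegral_mul_le hq hr hG
          (fun s => (continuous_fourier_of_integrable (h1 s)).aestronglyMeasurable) hM
          (fun s => (eLpNorm_fourier_le (h1 s) (h2 s)).trans ?_) (fun s y => ?_) hb
        · rw [eLpNorm_indicator_eq_eLpNorm_restrict hD.measurableSet]; exact ha s
        · change ‖𝓕 (Ω.indicator (Ψ s)) y‖ₑ ≤ M s
          rw [fourier_indicator_eq hD.measurableSet lam]; exact hΨM s y

end DispersiveGroup

/-! ### Forced evolutions: dual and retarded estimates. -/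

/-- The frequency profile `∫ σ(s) e^{-isλ} Ĝ(s) ds`. -/
noncomputable def profile (lam : Plane → ℝ) (σ : ℝ → ℂ) (G : ℝ → Plane → ℂ) (η : Plane) : ℂ :=
  ∫ s, σ s * (wave lam (-s) 0 η * 𝓕 (G s) η)

/-- A forcing term: integrable in space at each time, with Fourier transform bounded by an integrable
function of time. -/
structure Forcing (G : ℝ → Plane → ℂ) (b : ℝ → ℝ) : Prop where
  measurable : Measurable (Function.uncurry G)
  integrable : ∀ s, Integrable (G s)
  norm_fourier_le : ∀ s η, ‖𝓕 (G s) η‖ ≤ b s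
  integrable_bound : Integrable b

namespace DispersiveGroup

variable {lam : Plane → ℝ} {Ω : Set Plane} {A D : ℝ≥0∞} {G : ℝ → Plane → ℂ} {b : ℝ → ℝ}

lemma measurable_profile (hD : DispersiveGroup lam Ω A D) (hG : Forcing G b) {α : Type*}
    [MeasurableSpace α] {σ : α → ℝ → ℂ} (hσ : Measurable fun p : α × ℝ => σ p.1 p.2) {η : α → Plane}
    (hη : Measurable η) : Measurable fun a => profile lam (σ a) G (η a) := by
  have : Measurable fun z : α × ℝ =>
      σ z.1 z.2 * (wave lam (-z.2) 0 (η z.1) * 𝓕 (G z.2) (η z.1)) :=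
    hσ.mul ((measurable_wave hD.measurable_symbol (by fun_prop) measurable_const
      (hη.comp measurable_fst)).mul
      (measurable_fourier_comp hG.measurable measurable_snd (hη.comp measurable_fst)))
  exact this.stronglyMeasurable.integral_prod_right'.measurable

lemma norm_profile_integrand_le (hG : Forcing G b) {σ : ℝ → ℂ} (hσ1 : ∀ s, ‖σ s‖ ≤ 1)
    (s : ℝ) (η : Plane) : ‖σ s * (wave lam (-s) 0 η * 𝓕 (G s) η)‖ ≤ b s := by
  rw [norm_mul, norm_mul, norm_wave, one_mul]
  calc _ ≤ 1 * b s := mul_le_mul (hσ1 s) (hG.norm_fourier_le s η) (norm_nonneg _) zero_le_one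
    _ = b s := one_mul _

lemma norm_profile_le (hG : Forcing G b) {σ : ℝ → ℂ} (hσ1 : ∀ s, ‖σ s‖ ≤ 1) (η : Plane) :
    ‖profile lam σ G η‖ ≤ ∫ s, b s :=
  norm_integral_le_of_norm_le hG.integrable_bound
    (ae_of_all _ fun s => norm_profile_integrand_le hG hσ1 s η)

lemma measurable_profile_const (hD : DispersiveGroup lam Ω A D) (hG : Forcing G b) {σ : ℝ → ℂ}
    (hσ : Measurable σ) : Measurable (profile lam σ G) := by
  have hσ' : Measurable fun p : Plane × ℝ => σ p.2 := hσ.comp measurable_snd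
  exact hD.measurable_profile hG (σ := fun _ => σ) hσ' measurable_id

lemma memLp_profile (hD : DispersiveGroup lam Ω A D) (hG : Forcing G b) {σ : ℝ → ℂ}
    (hσ : Measurable σ) (hσ1 : ∀ s, ‖σ s‖ ≤ 1) (p : ℝ≥0∞) :
    MemLp (profile lam σ G) p (volume.restrict Ω) := by
  have := hD.isFiniteMeasure
  exact MemLp.of_bound (hD.measurable_profile_const hG hσ).aestronglyMeasurable _
    (ae_of_all _ fun η => norm_profile_le hG hσ1 η)

/-- **Dual Strichartz estimate**, with an arbitrary bounded weight in time. -/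
theorem eLpNorm_profile_le (hD : DispersiveGroup lam Ω A D) (hG : Forcing G b) {σ : ℝ → ℂ}
    (hσ : Measurable σ) (hσ1 : ∀ s, ‖σ s‖ ≤ 1) {q r q' r' : ℝ≥0∞}
    (h : HalfAdmissible q r) (hq : 1 / q + 1 / q' = 1) (hr : 1 / r + 1 / r' = 1) :
    eLpNorm (profile lam σ G) 2 (volume.restrict Ω) ≤
      D ^ admissibleExponent q * mixedNorm q' r' G := by
  have := hD.isFiniteMeasure
  set Φ := profile lam σ G with hΦ
  have hΦm : Measurable Φ := hD.measurable_profile_const hG hσ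
  have hΦ2 : MemLp Φ 2 (volume.restrict Ω) := hD.memLp_profile hG hσ hσ1 2
  obtain ⟨M, hM, hGM, hb⟩ := hD.exists_bound_evol hΦm hΦ2
  set B := eLpNorm Φ 2 (volume.restrict Ω) with hB
  -- Expanding one factor Φ of ‖Φ‖² pairs G with Ψ, whose transform is, up to σ and conjugation, the
  -- free evolution of Φ; the homogeneous bounds control it.
  set Ψ : ℝ → Plane → ℂ := fun s η => σ s * (wave lam (-s) 0 η * (starRingEnd ℂ) (Φ η)) with hΨ
  have hΨm : ∀ s, Measurable (Ψ s) := fun s => ((measurable_wave hD.measurable_symbol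
    measurable_const measurable_const measurable_id).mul
      (Complex.continuous_conj.measurable.comp hΦm)).const_mul _
  have hΨn : ∀ s η, ‖Ψ s η‖ ≤ ‖Φ η‖ := fun s η => by
    simp only [hΨ, norm_mul, norm_wave, one_mul, RCLike.norm_conj]
    exact mul_le_of_le_one_left (norm_nonneg _) (hσ1 s)
  have hΨ2 : ∀ s, MemLp (Ψ s) 2 (volume.restrict Ω) := fun s =>
    hΦ2.of_le (hΨm s).aestronglyMeasurable (ae_of_all _ (hΨn s))
  have hpair := hD.enorm_integral_fourier_mul_le h hq hr hG.measurable hG.integrable hΨ2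
    (fun s => eLpNorm_mono (hΨn s)) hM (fun s y => ?_) hb
  swap
  · have e : ∫ η in Ω, wave lam 0 (-y) η * Ψ s η =
        σ s * (starRingEnd ℂ) (evol lam Ω s Φ y) := by
      rw [evol, ← integral_conj, ← integral_const_mul]
      congr 1
      ext η
      simp only [hΨ, map_mul, conj_wave]
      have := wave_mul_wave lam 0 (-s) (-y) 0 η
      rw [zero_add, add_zero] at this
      rw [← this]; ring
    rw [e, enorm_mul, ← ofReal_norm ((starRingEnd ℂ) _), RCLike.norm_conj, ofReal_norm]
    refine le_trans ?_ (hGM s y)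
    refine mul_le_of_le_one_left zero_le ?_
    rw [← ofReal_norm]; exact ENNReal.ofReal_le_one.2 (hσ1 s)
  rw [rpow_one_sub_mul_mul_rpow _ _ (admissibleExponent_nonneg q) h.exponent_le_one] at hpair
  have hswap : ∫ η in Ω, Φ η * (starRingEnd ℂ) (Φ η) = ∫ s, ∫ η in Ω, 𝓕 (G s) η * Ψ s η := by
    set f : Plane → ℝ → ℂ := fun η s => 𝓕 (G s) η * Ψ s η with hf
    have hfm : Measurable (Function.uncurry f) := by
      refine (measurable_fourier_comp hG.measurable measurable_snd measurable_fst).mul ?_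
      exact (hσ.comp measurable_snd).mul ((measurable_wave hD.measurable_symbol (by fun_prop)
        measurable_const measurable_fst).mul
        (Complex.continuous_conj.measurable.comp (hΦm.comp measurable_fst)))
    have hfi : Integrable (Function.uncurry f) ((volume.restrict Ω).prod volume) := by
      refine integrable_prod_of_norm_le hfm (hG.integrable_bound.mul_const (∫ s, b s))
        fun η s => ?_
      simp only [hf, Function.uncurry, norm_mul]
      have hb0 : 0 ≤ b s := (norm_nonneg _).trans (hG.norm_fourier_le s η)
      exact mul_le_mul (hG.norm_fourier_le s η)
        ((hΨn s η).trans (norm_profile_le hG hσ1 η)) (norm_nonneg _) hb0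
    rw [← integral_integral_swap hfi]
    refine integral_congr_ae (ae_of_all _ fun η => ?_)
    simp only [hf, hΨ]
    nth_rewrite 1 [hΦ]
    rw [profile, ← integral_mul_const]
    congr 1
    ext s
    ring
  rw [← hswap, ← eLpNorm_two_rpow_eq_enorm_integral hΦ2, ← hB] at hpair
  -- The pairing gives B² ≤ (bound)·B; one factor B, finite and nonzero, is cancelled.
  rcases eq_or_ne B 0 with h0 | h0
  · rw [h0]; exact zero_le
  have hBt : B ≠ ⊤ := hΦ2.eLpNorm_ne_top
  rw [← ENNReal.mul_le_mul_iff_left h0 hBt]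
  calc B * B = B ^ (2 : ℝ) := by
        rw [show (2 : ℝ) = ((2 : ℕ) : ℝ) by norm_num, ENNReal.rpow_natCast]; ring
    _ ≤ _ := hpair
    _ = _ := by ring

/-- Superposing in time the free evolutions of a forcing term amounts to the free evolution of its
profile. -/
lemma integral_evol_eq_evol_profile (hD : DispersiveGroup lam Ω A D) (hG : Forcing G b) {σ : ℝ → ℂ}
    (hσ : Measurable σ) (hσ1 : ∀ s, ‖σ s‖ ≤ 1) (t : ℝ) (x : Plane) :
    ∫ s, σ s * evol lam Ω (t - s) (𝓕 (G s)) x = evol lam Ω t (profile lam σ G) x := by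
  have := hD.isFiniteMeasure
  set f : Plane → ℝ → ℂ := fun η s => σ s * (wave lam (t - s) x η * 𝓕 (G s) η) with hf
  have hfm : Measurable (Function.uncurry f) :=
    (hσ.comp measurable_snd).mul ((measurable_wave hD.measurable_symbol (by fun_prop)
      measurable_const measurable_fst).mul
      (measurable_fourier_comp hG.measurable measurable_snd measurable_fst))
  have hfi : Integrable (Function.uncurry f) ((volume.restrict Ω).prod volume) := by
    refine integrable_prod_of_norm_le hfm hG.integrable_bound fun η s => ?_
    simp only [hf, Function.uncurry, norm_mul, norm_wave, one_mul]
    exact (mul_le_of_le_one_left (norm_nonneg _) (hσ1 s)).trans (hG.norm_fourier_le s η)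
  simp only [evol, profile, ← integral_const_mul]
  refine (integral_integral_swap hfi).symm.trans ?_
  refine integral_congr_ae (ae_of_all _ fun η => integral_congr_ae (ae_of_all _ fun s => ?_))
  have := wave_mul_wave lam t (-s) x 0 η
  rw [add_zero, ← sub_eq_add_neg] at this
  simp only [hf]
  rw [← this]; ring

/-- Duality for the retarded operator, tested against a measure carried by a measurable curve. -/
theorem enorm_integral_mul_evol_profile_le (hD : DispersiveGroup lam Ω A D) (hG : Forcing G b)
    {σ : ℝ → ℝ → ℂ} (hσ : Measurable fun p : ℝ × ℝ => σ p.1 p.2) (hσ1 : ∀ t s, ‖σ t s‖ ≤ 1)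
    {q r q' r' : ℝ≥0∞} (hqr : HalfAdmissible q r) (hq : 1 / q + 1 / q' = 1)
    (hr : 1 / r + 1 / r' = 1) {X : ℝ → Plane} (hX : Measurable X) {h : ℝ → ℂ} (hh : Measurable h)
    (hi : Integrable h) :
    ‖∫ t, h t * evol lam Ω t (profile lam (σ t) G) (X t)‖ₑ ≤
      D * (D ^ admissibleExponent q * mixedNorm q' r' G) * normFourThirds h := by
  have := hD.isFiniteMeasure
  set f : Plane × (ℝ × ℝ) → ℂ := fun z => h z.2.1 * (wave lam z.2.1 (X z.2.1) z.1 *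
    (σ z.2.1 z.2.2 * (wave lam (-z.2.2) 0 z.1 * 𝓕 (G z.2.2) z.1))) with hf
  have hfm : Measurable f := by
    refine (hh.comp (by fun_prop)).mul ((measurable_wave hD.measurable_symbol (by fun_prop)
      (by fun_prop) (by fun_prop)).mul ((hσ.comp measurable_snd).mul
      ((measurable_wave hD.measurable_symbol (by fun_prop) measurable_const (by fun_prop)).mul
      (measurable_fourier_comp hG.measurable (by fun_prop) (by fun_prop)))))
  have hfn : ∀ η t s, ‖f (η, (t, s))‖ ≤ ‖h t‖ * b s := fun η t s => by
    simp only [hf, norm_mul, norm_wave, one_mul]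
    gcongr
    exact (mul_le_of_le_one_left (norm_nonneg _) (hσ1 t s)).trans (hG.norm_fourier_le s η)
  have hfi : Integrable f ((volume.restrict Ω).prod (volume.prod volume)) :=
    integrable_prod_of_norm_le hfm (g := fun p : ℝ × ℝ => ‖h p.1‖ * b p.2)
      (hi.norm.mul_prod hG.integrable_bound) fun η p => hfn η p.1 p.2
  have hft : ∀ t, Integrable (Function.uncurry fun η s => f (η, (t, s)))
      ((volume.restrict Ω).prod volume) := fun t =>
    integrable_prod_of_norm_le (hfm.comp (by fun_prop : Measurable fun p : Plane × ℝ =>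
      (p.1, (t, p.2)))) (hG.integrable_bound.const_mul ‖h t‖) fun η s => hfn η t s
  have hfs : ∀ s, Integrable (Function.uncurry fun η t => f (η, (t, s)))
      ((volume.restrict Ω).prod volume) := fun s =>
    integrable_prod_of_norm_le (hfm.comp (by fun_prop : Measurable fun p : Plane × ℝ =>
      (p.1, (p.2, s)))) (hi.norm.mul_const (b s)) fun η t => hfn η t s
  have hms : ∀ s, Measurable fun t => h t * σ t s := fun s =>
    hh.mul (hσ.comp (measurable_id.prodMk measurable_const))
  have hns : ∀ s t, ‖h t * σ t s‖ ≤ ‖h t‖ := fun s t => by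
    rw [norm_mul]; exact mul_le_of_le_one_right (norm_nonneg _) (hσ1 t s)
  have hes : ∀ s t, ‖h t * σ t s‖ₑ ≤ ‖h t‖ₑ := fun s t => by
    rw [← ofReal_norm, ← ofReal_norm]; exact ENNReal.ofReal_le_ofReal (hns s t)
  have his : ∀ s, Integrable fun t => h t * σ t s := fun s =>
    hi.mono (hms s).aestronglyMeasurable (ae_of_all _ (hns s))
  -- For fixed s the t-integral is a wave packet with density h(t)σ(t,s), which is dominated by |h|;
  -- this gives an L² bound uniform in s.
  set V : ℝ → Plane → ℂ := fun s η => ∫ t, h t * σ t s * wave lam t (X t) η with hV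
  set Ψ : ℝ → Plane → ℂ := fun s η => wave lam (-s) 0 η * V s η with hΨ
  have hVm : ∀ s, Measurable (V s) := fun s => hD.measurable_packet hX (hms s)
  have hΨm : ∀ s, Measurable (Ψ s) := fun s => (measurable_wave hD.measurable_symbol
    measurable_const measurable_const measurable_id).mul (hVm s)
  have hΨn : ∀ s η, ‖Ψ s η‖ = ‖V s η‖ := fun s η => by
    simp only [hΨ, norm_mul, norm_wave, one_mul]
  have hΨ2 : ∀ s, MemLp (Ψ s) 2 (volume.restrict Ω) := fun s =>
    (hD.memLp_packet hX (hms s) 2).of_le (hΨm s).aestronglyMeasurable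
      (ae_of_all _ fun η => (hΨn s η).le)
  have hΨa : ∀ s, eLpNorm (Ψ s) 2 (volume.restrict Ω) ≤ D * normFourThirds h := fun s => by
    rw [eLpNorm_congr_norm_ae (ae_of_all _ (hΨn s))]
    refine (hD.eLpNorm_packet_le hX (hms s) (his s)).trans ?_
    unfold normFourThirds
    gcongr with t
    exact hes s t
  -- Majorant of the spatial supremum: bounding the kernel by its absolute value discards σ, leaving
  -- the fractional integral of |h|.
  set M : ℝ → ℝ≥0∞ := fun s => A * ∫⁻ t, ‖h t‖ₑ * rieszKernel (s - t) with hM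
  have hkm : Measurable fun p : ℝ × ℝ => ‖h p.2‖ₑ * rieszKernel (p.1 - p.2) :=
    (hh.enorm.comp measurable_snd).mul
      (measurable_rieszKernel.comp (measurable_fst.sub measurable_snd))
  have hMm : Measurable M := hkm.lintegral_prod_right'.const_mul _
  -- Fractional integration L^{4/3} → L⁴ with 12A ≤ D². The result is D times the L^∞L² bound, ready
  -- for interpolation in (q,r).
  have hM4 : ∫⁻ s, M s ^ (4 : ℝ) ≤ (D * (D * normFourThirds h)) ^ (4 : ℝ) := by
    have h4 := lintegral_lintegral_rieszKernel_pow_four_le hh.enorm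
    simp only [hM]
    simp_rw [ENNReal.mul_rpow_of_nonneg A _ (show (0 : ℝ) ≤ 4 by norm_num)]
    rw [lintegral_const_mul _ (hkm.lintegral_prod_right'.pow_const _)]
    calc _ ≤ A ^ (4 : ℝ) * (12 * normFourThirds h) ^ (4 : ℝ) := by gcongr; exact h4
      _ = (12 * A * normFourThirds h) ^ (4 : ℝ) := by
          rw [← ENNReal.mul_rpow_of_nonneg _ _ (by norm_num)]; ring_nf
      _ ≤ (D ^ (2 : ℝ) * normFourThirds h) ^ (4 : ℝ) := by gcongr; exact hD.const_le
      _ = _ := by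
          rw [show (2 : ℝ) = ((2 : ℕ) : ℝ) by norm_num, ENNReal.rpow_natCast]; ring_nf
  have hWM : ∀ s y, ‖∫ η in Ω, wave lam 0 (-y) η * Ψ s η‖ₑ ≤ M s := by
    intro s y
    set g : Plane → ℝ → ℂ := fun η t => h t * σ t s * wave lam (t - s) (X t - y) η with hg
    have hgm : Measurable (Function.uncurry g) :=
      ((hms s).comp measurable_snd).mul (measurable_wave hD.measurable_symbol (by fun_prop)
        (by fun_prop) measurable_fst)
    have hgi : Integrable (Function.uncurry g) ((volume.restrict Ω).prod volume) :=
      integrable_prod_of_norm_le hgm hi.norm fun η t => by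
        simp only [hg, Function.uncurry]
        rw [norm_mul, norm_wave, mul_one]; exact hns s t
    have e : ∫ η in Ω, wave lam 0 (-y) η * Ψ s η =
        ∫ t, h t * σ t s * ∫ η in Ω, wave lam (t - s) (X t - y) η := by
      simp_rw [← integral_const_mul]
      rw [← integral_integral_swap hgi]
      refine integral_congr_ae (ae_of_all _ fun η => ?_)
      simp only [hΨ, hV, hg]
      rw [← mul_assoc, ← integral_const_mul]
      refine integral_congr_ae (ae_of_all _ fun t => ?_)
      dsimp only
      rw [wave_mul_wave, mul_left_comm, wave_mul_wave]
      congr 2 <;> abel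
    rw [e]
    refine (enorm_integral_le_lintegral_enorm _).trans ?_
    have hkms : Measurable fun t => ‖h t‖ₑ * rieszKernel (s - t) := hkm.comp measurable_prodMk_left
    simp only [hM]
    rw [← lintegral_const_mul _ hkms]
    refine lintegral_mono fun t => ?_
    dsimp only
    rw [enorm_mul]
    calc _ ≤ ‖h t‖ₑ * (A * rieszKernel (t - s)) := by
          gcongr
          exacts [hes s t, hD.kernel_le _ _]
      _ = _ := by rw [rieszKernel_sub_comm]; ring
  have hpair := hD.enorm_integral_fourier_mul_le hqr hq hr hG.measurable hG.integrable hΨ2 hΨa hMm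
    hWM hM4
  rw [rpow_one_sub_mul_mul_rpow _ _ (admissibleExponent_nonneg q) hqr.exponent_le_one] at hpair
  refine le_trans (le_of_eq ?_) (hpair.trans (le_of_eq (by ring)))
  congr 1
  -- Three Fubini swaps bring the s-integral outermost, so that G(s) can be separated from the
  -- packet.
  calc ∫ t, h t * evol lam Ω t (profile lam (σ t) G) (X t)
      = ∫ t, ∫ η in Ω, ∫ s, f (η, (t, s)) := by
        simp only [evol, profile, hf, integral_const_mul]
    _ = ∫ t, ∫ s, ∫ η in Ω, f (η, (t, s)) := by
        refine integral_congr_ae (ae_of_all _ fun t => ?_)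
        exact integral_integral_swap (hft t)
    _ = ∫ s, ∫ t, ∫ η in Ω, f (η, (t, s)) :=
        integral_integral_swap (f := fun t s => ∫ η in Ω, f (η, (t, s))) hfi.integral_prod_right
    _ = ∫ s, ∫ η in Ω, ∫ t, f (η, (t, s)) := by
        refine integral_congr_ae (ae_of_all _ fun s => ?_)
        exact (integral_integral_swap (hfs s)).symm
    _ = ∫ s, ∫ η in Ω, 𝓕 (G s) η * Ψ s η := by
        refine integral_congr_ae (ae_of_all _ fun s => integral_congr_ae (ae_of_all _ fun η => ?_))
        simp only [hf, hΨ, hV]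
        rw [← mul_assoc, ← integral_const_mul]
        refine integral_congr_ae (ae_of_all _ fun t => ?_)
        dsimp only
        ring

/-- **Inhomogeneous Strichartz estimate**, with an arbitrary bounded weight `σ(t,s)` in time. -/
theorem mixedNorm_evol_profile_le (hD : DispersiveGroup lam Ω A D) (hG : Forcing G b)
    {σ : ℝ → ℝ → ℂ} (hσ : Measurable fun p : ℝ × ℝ => σ p.1 p.2) (hσ1 : ∀ t s, ‖σ t s‖ ≤ 1)
    {q₁ r₁ q₂ r₂ q₂' r₂' : ℝ≥0∞} (h₁ : HalfAdmissible q₁ r₁) (h₂ : HalfAdmissible q₂ r₂)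
    (hq : 1 / q₂ + 1 / q₂' = 1) (hr : 1 / r₂ + 1 / r₂' = 1) :
    mixedNorm q₁ r₁ (fun t => evol lam Ω t (profile lam (σ t) G)) ≤
      D ^ admissibleExponent q₁ * (D ^ admissibleExponent q₂ * mixedNorm q₂' r₂' G) := by
  have := hD.isFiniteMeasure
  have hσt : ∀ t, Measurable (σ t) := fun t => hσ.comp measurable_prodMk_left
  have hΦ2 : ∀ t p, MemLp (profile lam (σ t) G) p (volume.restrict Ω) := fun t p =>
    hD.memLp_profile hG (hσt t) (hσ1 t) p
  have hcont : ∀ t, Continuous (evol lam Ω t (profile lam (σ t) G)) := fun t =>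
    continuous_evol hD.measurable_symbol t ((hΦ2 t 1).integrable le_rfl)
  have hσ' : Measurable fun p : (ℝ × Plane) × ℝ => σ p.1.1 p.2 :=
    hσ.comp (by fun_prop : Measurable fun p : (ℝ × Plane) × ℝ => (p.1.1, p.2))
  have hum := hD.measurable_evol (Φ := fun t => profile lam (σ t) G)
    (hD.measurable_profile hG (σ := fun p : ℝ × Plane => σ p.1) hσ' measurable_snd)
  -- L⁴L^∞ end in the first pair, by duality along curves; the L^∞L² end below is the dual estimate
  -- with weight σ(t,·) at each fixed t.
  obtain ⟨M, hM, hGM, hb⟩ := exists_measurable_bound_of_forall_section hum hcont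
    (B := (D * (D ^ admissibleExponent q₂ * mixedNorm q₂' r₂' G)) ^ (4 : ℝ)) fun X hX => by
      refine lintegral_enorm_pow_four_le (hum.comp (measurable_id.prodMk hX))
        (c := ∫ η in Ω, ∫ s, b s) (fun t => (norm_evol_le t _ (X t)).trans ?_) _ fun h hh hi =>
        hD.enorm_integral_mul_evol_profile_le hG hσ hσ1 h₂ hq hr hX hh hi
      exact integral_mono ((hΦ2 t 1).integrable le_rfl).norm (integrable_const _) fun η =>
        norm_profile_le hG (hσ1 t) η
  refine (h₁.mixedNorm_le (fun t => (hcont t).aestronglyMeasurable) hM (fun t =>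
    (eLpNorm_evol_le hD.measurable_symbol hD.measurableSet hD.volume_ne_top t (hΦ2 t 2)).trans
      (hD.eLpNorm_profile_le hG (hσt t) (hσ1 t) h₂ hq hr)) hGM hb).trans (le_of_eq ?_)
  exact rpow_one_sub_mul_mul_rpow _ _ (admissibleExponent_nonneg _) h₁.exponent_le_one

end DispersiveGroup

/-! ### The localised group `e^{itΛ_κ} P_k` -/

/-- The inner radius of the annulus containing the frequencies of `P_k`. -/
noncomputable def innerRadius (k : ℤ) : ℝ := (2 : ℝ) ^ k / (4 * Real.pi)

lemma innerRadius_pos (k : ℤ) : 0 < innerRadius k := by unfold innerRadius; positivity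

lemma measurable_dispersion (κ : ℝ) : Measurable (dispersion κ) := by
  unfold dispersion; fun_prop

/-- Degree-0 homogeneity makes the factor 2π of the Fourier normalisation harmless. -/
lemma dispersion_smul (κ : ℝ) {c : ℝ} (hc : 0 < c) (ξ : Plane) :
    dispersion κ (c • ξ) = dispersion κ ξ := by
  unfold dispersion
  rw [norm_smul, Real.norm_of_nonneg hc.le, PiLp.smul_apply, smul_eq_mul,
    mul_div_mul_left _ _ hc.ne']

/-- With a = 2^k/(4π), 12·1680·a² = (1260/π²)·4^k ≤ 140·4^k by π² ≥ 9, which fits under 12²·4^k; the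
powers of κ match since D² carries κ^{-1/2}. -/
lemma dispersiveGroup {κ : ℝ} (hκ : 0 < κ) (k : ℤ) :
    DispersiveGroup (dispersion κ) (annulus (innerRadius k))
      (ENNReal.ofReal (1680 * innerRadius k ^ 2) * ENNReal.ofReal (κ ^ (-(1 / 2) : ℝ)))
      (ENNReal.ofReal (12 * (2 : ℝ) ^ k * κ ^ (-(1 / 4) : ℝ))) where
  measurable_symbol := measurable_dispersion κ
  measurableSet := measurableSet_annulus _
  volume_ne_top := by
    refine ne_top_of_le_ne_top (measure_closedBall_lt_top (x := (0 : Plane))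
      (r := 4 * innerRadius k)).ne (measure_mono fun η hη => ?_)
    rw [mem_closedBall_zero_iff]; exact hη.2
  kernel_le t x := by
    refine (enorm_setIntegral_annulus_wave_le (innerRadius_pos k) κ t x).trans (le_of_eq ?_)
    rw [rieszKernel_mul hκ]; ring
  const_le := by
    have h2 : (0 : ℝ) < (2 : ℝ) ^ k := by positivity
    rw [show (12 : ℝ≥0∞) = ENNReal.ofReal 12 by simp, ← ENNReal.ofReal_mul (by positivity),
      ← ENNReal.ofReal_mul (by norm_num), ENNReal.ofReal_rpow_of_pos (by positivity)]
    apply ENNReal.ofReal_le_ofReal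
    have e : (κ ^ (-(1 / 4) : ℝ)) ^ (2 : ℕ) = κ ^ (-(1 / 2) : ℝ) := by
      rw [← Real.rpow_natCast, ← Real.rpow_mul hκ.le]; norm_num
    rw [show (2 : ℝ) = ((2 : ℕ) : ℝ) by norm_num, Real.rpow_natCast, mul_pow, mul_pow, e,
      ← mul_assoc]
    refine mul_le_mul_of_nonneg_right ?_ (by positivity)
    unfold innerRadius
    rw [div_pow, mul_pow]
    have hp : (9 : ℝ) ≤ Real.pi ^ 2 := by nlinarith [Real.pi_gt_three]
    push_cast
    rw [← mul_assoc, ← mul_div_assoc, div_le_iff₀ (by positivity)]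
    nlinarith [sq_nonneg ((2 : ℝ) ^ k), mul_le_mul_of_nonneg_left hp (sq_nonneg ((2 : ℝ) ^ k))]

/-- Converts D^{4x} into the scaling factor of the theorem; x is 1/q, or 1/q₁ + 1/q₂ in the retarded
case. -/
lemma ofReal_rpow_admissible {κ : ℝ} (hκ : 0 < κ) (k : ℤ) (x : ℝ) :
    ENNReal.ofReal (12 * (2 : ℝ) ^ k * κ ^ (-(1 / 4) : ℝ)) ^ (4 * x) =
      ((12 : ℝ≥0) ^ (4 * x) : ℝ≥0) * strichartzFactor κ k x := by
  have h2 : (0 : ℝ) < (2 : ℝ) ^ k := by positivity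
  rw [ENNReal.ofReal_rpow_of_pos (by positivity), mul_assoc, Real.mul_rpow (by norm_num)
    (by positivity), Real.mul_rpow h2.le (by positivity), ENNReal.ofReal_mul (by positivity),
    strichartzFactor]
  congr 1
  · rw [← ENNReal.ofReal_coe_nnreal]; simp
  · congr 1
    rw [mul_comm, ← Real.rpow_mul hκ.le, ← Real.rpow_intCast, ← Real.rpow_mul (by norm_num)]
    congr 2 <;> ring

/-! ### Littlewood–Paley projections of Schwartz functions -/

lemma IsBump.dyadicCutoff_eq_zero {ψ : ℝ → ℝ} (hψ : IsBump ψ) {x : ℝ} (hx : 0 ≤ x)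
    (h : x ∉ Set.Icc (1 / 2 : ℝ) 2) :
    dyadicCutoff ψ x = 0 := by
  have hz : ∀ y : ℝ, 2 < y → ψ y = 0 := fun y hy => image_eq_zero_of_notMem_tsupport fun hm =>
    absurd (hψ.tsupport_subset hm).2 (not_le.2 hy)
  unfold dyadicCutoff
  rw [Set.mem_Icc, not_and_or, not_le, not_le] at h
  rcases h with h | h
  · rw [hψ.eq_one x ⟨by linarith, by linarith⟩, hψ.eq_one (2 * x) ⟨by linarith, by linarith⟩, sub_self]
  · rw [hz x h, hz (2 * x) (by linarith), sub_self]

lemma IsBump.abs_dyadicCutoff_le {ψ : ℝ → ℝ} (hψ : IsBump ψ) (x : ℝ) : |dyadicCutoff ψ x| ≤ 1 := by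
  unfold dyadicCutoff
  have h1 := hψ.mem_Icc x
  have h2 := hψ.mem_Icc (2 * x)
  exact abs_le.2 ⟨by linarith [h1.1, h2.2], by linarith [h1.2, h2.1]⟩

/-- The symbol of `P_k` in Mathlib's normalisation of the Fourier transform. -/
noncomputable def lpSymbol (ψ : ℝ → ℝ) (k : ℤ) (η : Plane) : ℂ :=
  (dyadicCutoff ψ ((2 : ℝ) ^ (-k) * ‖(2 * Real.pi) • η‖) : ℂ)

/-- In the variable ξ = 2πη, the support 1/2 ≤ 2^{-k}|ξ| ≤ 2 reads 2^k/(4π) ≤ |η| ≤ 2^k/π. -/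
lemma IsBump.lpSymbol_eq_zero {ψ : ℝ → ℝ} (hψ : IsBump ψ) {k : ℤ} {η : Plane} (h : η ∉ annulus (innerRadius k)) :
    lpSymbol ψ k η = 0 := by
  unfold lpSymbol
  rw [hψ.dyadicCutoff_eq_zero (by positivity), Complex.ofReal_zero]
  refine fun hm => h ?_
  have hk : (0 : ℝ) < 2 ^ k := by positivity
  have hn : (2 : ℝ) ^ (-k) * ‖(2 * Real.pi) • η‖ = 2 * Real.pi * ‖η‖ / 2 ^ k := by
    rw [norm_smul, Real.norm_of_nonneg (by positivity), zpow_neg]; field_simp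
  rw [hn, Set.mem_Icc, le_div_iff₀ hk, div_le_iff₀ hk] at hm
  unfold innerRadius
  have hp := Real.pi_pos
  refine ⟨?_, ?_⟩
  · rw [div_le_iff₀ (by positivity)]; nlinarith [hm.1]
  · rw [← mul_div_assoc, le_div_iff₀ (by positivity)]; nlinarith [hm.2]

lemma IsBump.norm_lpSymbol_le {ψ : ℝ → ℝ} (hψ : IsBump ψ) (k : ℤ) (η : Plane) : ‖lpSymbol ψ k η‖ ≤ 1 := by
  unfold lpSymbol
  rw [Complex.norm_real]; exact hψ.abs_dyadicCutoff_le _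

/-- The norm is not smooth at the origin, but the symbol vanishes in a neighbourhood of it. -/
lemma IsBump.contDiff_lpSymbol {ψ : ℝ → ℝ} (hψ : IsBump ψ) (k : ℤ) : ContDiff ℝ ∞ (lpSymbol ψ k) := by
  rw [contDiff_iff_contDiffAt]
  intro η
  by_cases hη : η = 0
  · have : lpSymbol ψ k =ᶠ[nhds η] fun _ => 0 := by
      have hmem : Metric.ball (0 : Plane) (innerRadius k) ∈ nhds η := by
        rw [hη]; exact Metric.ball_mem_nhds _ (innerRadius_pos k)
      filter_upwards [hmem] with ζ hζ
      refine hψ.lpSymbol_eq_zero fun h => ?_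
      rw [mem_ball_zero_iff] at hζ
      exact absurd h.1 (not_le.2 hζ)
    exact contDiffAt_const.congr_of_eventuallyEq this
  · have hne : (2 * Real.pi) • η ≠ 0 := smul_ne_zero (by positivity) hη
    have h1 : ContDiffAt ℝ ∞ (fun η : Plane => (2 : ℝ) ^ (-k) * ‖(2 * Real.pi) • η‖) η :=
      contDiffAt_const.mul ((contDiffAt_norm ℝ hne).comp η (contDiffAt_id.const_smul _))
    have h2 : ContDiff ℝ ∞ (dyadicCutoff ψ) := by
      unfold dyadicCutoff
      exact hψ.smooth.sub (hψ.smooth.comp (contDiff_const.mul contDiff_id))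
    exact Complex.ofRealCLM.contDiff.contDiffAt.comp η (h2.contDiffAt.comp η h1)

lemma IsBump.hasCompactSupport_lpSymbol {ψ : ℝ → ℝ} (hψ : IsBump ψ) (k : ℤ) : HasCompactSupport (lpSymbol ψ k) := by
  refine HasCompactSupport.intro (isCompact_closedBall (0 : Plane) (4 * innerRadius k)) fun η hη => ?_
  refine hψ.lpSymbol_eq_zero fun h => hη ?_
  rw [mem_closedBall_zero_iff]; exact h.2

/-- `P_k` of a Schwartz function is a Schwartz function, with Fourier transform `φ_k f̂`. -/
lemma IsBump.exists_schwartz_eq_lpProj {ψ : ℝ → ℝ} (hψ : IsBump ψ) (k : ℤ) (f : 𝓢(Plane, ℂ)) :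
    ∃ g : 𝓢(Plane, ℂ), ⇑g = lpProj ψ k f ∧
      𝓕 (g : Plane → ℂ) = fun η => lpSymbol ψ k η * 𝓕 (f : Plane → ℂ) η := by
  have hcs : HasCompactSupport fun η => lpSymbol ψ k η * 𝓕 (f : Plane → ℂ) η :=
    (hψ.hasCompactSupport_lpSymbol k).mul_right
  have hcd : ContDiff ℝ ∞ fun η => lpSymbol ψ k η * 𝓕 (f : Plane → ℂ) η := by
    refine (hψ.contDiff_lpSymbol k).mul ?_
    rw [← SchwartzMap.fourier_coe]; exact (𝓕 f).smooth ⊤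
  set G : 𝓢(Plane, ℂ) := hcs.toSchwartzMap hcd with hG
  refine ⟨𝓕⁻ G, ?_, ?_⟩
  · rw [SchwartzMap.fourierInv_coe]; rfl
  · rw [← SchwartzMap.fourier_coe, FourierTransform.fourier_fourierInv_eq]; rfl

/-- On the range of `P_k` the group is given by the localised evolution. -/
lemma IsBump.propagator_lpProj {ψ : ℝ → ℝ} (hψ : IsBump ψ) (κ t : ℝ) (k : ℤ) (f : 𝓢(Plane, ℂ)) :
    propagator κ t (lpProj ψ k f) =
      evol (dispersion κ) (annulus (innerRadius k)) t (𝓕 (lpProj ψ k f)) := by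
  obtain ⟨g, hg, hgF⟩ := hψ.exists_schwartz_eq_lpProj k f
  rw [← hg, evol_eq_fourierInv (measurableSet_annulus _), propagator, fourierMult]
  congr 1
  ext η
  by_cases h : η ∈ annulus (innerRadius k)
  · rw [Set.indicator_of_mem h, dispersion_smul κ (by positivity)]
    congr 1
    unfold wave
    rw [inner_zero_left, mul_zero, zero_add]
  · rw [Set.indicator_of_notMem h, hgF]
    simp only [hψ.lpSymbol_eq_zero h, zero_mul, mul_zero]

/-- The restriction of a space-time Schwartz function to a time slice. -/
lemma exists_schwartz_slice (F : 𝓢(ℝ × Plane, ℂ)) (s : ℝ) :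
    ∃ f : 𝓢(Plane, ℂ), ⇑f = fun x => F (s, x) := by
  have hg : Function.HasTemperateGrowth fun x : Plane => ((s, x) : ℝ × Plane) := by
    have h1 := Function.HasTemperateGrowth.const (E := Plane) ((s, 0) : ℝ × Plane)
    have h2 := (ContinuousLinearMap.inr ℝ ℝ Plane).hasTemperateGrowth
    have h3 := h1.add h2
    convert h3 using 1
    ext x <;> simp
  refine ⟨SchwartzMap.compCLM ℂ hg ⟨1, 1, fun x => ?_⟩ F, rfl⟩
  have : ‖x‖ ≤ ‖((s, x) : ℝ × Plane)‖ := le_max_right _ _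
  rw [pow_one, one_mul]; linarith

/-- `P_k F` is an admissible forcing term. -/
lemma IsBump.forcing_lpProjSpace {ψ : ℝ → ℝ} (hψ : IsBump ψ) (k : ℤ) (F : 𝓢(ℝ × Plane, ℂ)) :
    Forcing (lpProjSpace ψ k F) fun s => ∫ x, ‖F (s, x)‖ where
  measurable := by
    have hF : Measurable (Function.uncurry fun s x => F (s, x)) := F.continuous.measurable
    have hS : Measurable (Function.uncurry fun s η =>
        lpSymbol ψ k η * 𝓕 (fun x => F (s, x)) η) :=
      ((hψ.contDiff_lpSymbol k).continuous.measurable.comp measurable_snd).mul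
        (measurable_fourier_comp (G := fun s x => F (s, x)) hF measurable_fst measurable_snd)
    have := measurable_fourier_comp hS (measurable_fst (α := ℝ) (β := Plane))
      (measurable_snd (α := ℝ) (β := Plane)).neg
    have e : Function.uncurry (lpProjSpace ψ k F) =
        fun p => 𝓕 (fun η => lpSymbol ψ k η * 𝓕 (fun x => F (p.1, x)) η) (-p.2) := by
      ext ⟨s, x⟩; exact Real.fourierInv_eq_fourier_neg _ _
    rw [e]
    exact this
  integrable s := by
    obtain ⟨f, hf⟩ := exists_schwartz_slice F s
    obtain ⟨g, hg, -⟩ := hψ.exists_schwartz_eq_lpProj k f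
    unfold lpProjSpace
    rw [← hf, ← hg]; exact g.integrable
  norm_fourier_le s η := by
    obtain ⟨f, hf⟩ := exists_schwartz_slice F s
    obtain ⟨g, hg, hgF⟩ := hψ.exists_schwartz_eq_lpProj k f
    unfold lpProjSpace
    rw [← hf, ← hg, hgF, norm_mul]
    refine (mul_le_of_le_one_left (norm_nonneg _) (hψ.norm_lpSymbol_le k η)).trans ?_
    refine (VectorFourier.norm_fourierIntegral_le_integral_norm _ _ _ _ _).trans (le_of_eq ?_)
    rw [hf]
  integrable_bound := by
    have : Integrable (F : ℝ × Plane → ℂ) (volume.prod volume) := F.integrable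
    exact this.integral_norm_prod_left

lemma IsBump.propagator_lpProjSpace {ψ : ℝ → ℝ} (hψ : IsBump ψ) (κ t : ℝ) (k : ℤ) (F : 𝓢(ℝ × Plane, ℂ)) (s : ℝ) :
    propagator κ t (lpProjSpace ψ k F s) =
      evol (dispersion κ) (annulus (innerRadius k)) t (𝓕 (lpProjSpace ψ k F s)) := by
  obtain ⟨f, hf⟩ := exists_schwartz_slice F s
  unfold lpProjSpace
  rw [← hf]
  exact hψ.propagator_lpProj κ t k f

/-! ### The time cutoff of the Duhamel integral. -/

/-- The weight turning an integral over the line into `∫_0^t`. -/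
noncomputable def retardedWeight (t s : ℝ) : ℂ :=
  {p : ℝ × ℝ | 0 < p.2 ∧ p.2 ≤ p.1}.indicator 1 (t, s) -
    {p : ℝ × ℝ | p.1 < p.2 ∧ p.2 ≤ 0}.indicator 1 (t, s)

lemma measurable_retardedWeight : Measurable fun p : ℝ × ℝ => retardedWeight p.1 p.2 :=
  (measurable_one.indicator ((measurableSet_lt measurable_const measurable_snd).inter
    (measurableSet_le measurable_snd measurable_fst))).sub
  (measurable_one.indicator ((measurableSet_lt measurable_fst measurable_snd).inter
    (measurableSet_le measurable_snd measurable_const)))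

lemma norm_retardedWeight_le (t s : ℝ) : ‖retardedWeight t s‖ ≤ 1 := by
  unfold retardedWeight
  by_cases h1 : 0 < s ∧ s ≤ t
  · have h2 : ¬ (t < s ∧ s ≤ 0) := fun h => absurd h1.1 (not_lt.2 h.2)
    simp [h1, h2]
  · by_cases h2 : t < s ∧ s ≤ 0 <;> simp [h1, h2]

/-- For t < 0 the oriented integral is minus the integral over (t,0], hence the subtracted indicator
in the weight. -/
lemma integral_retardedWeight_mul (t : ℝ) (f : ℝ → ℂ) :
    ∫ s, retardedWeight t s * f s = ∫ s in (0 : ℝ)..t, f s := by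
  rcases le_total 0 t with h | h
  · rw [intervalIntegral.integral_of_le h, ← integral_indicator measurableSet_Ioc]
    congr 1
    ext s
    have h2 : ¬ (t < s ∧ s ≤ 0) := fun h' => absurd (h.trans_lt h'.1) (not_lt.2 h'.2)
    by_cases h1 : 0 < s ∧ s ≤ t <;> simp [retardedWeight, h1, h2]
  · rw [intervalIntegral.integral_of_ge h, ← integral_indicator measurableSet_Ioc, ← integral_neg]
    congr 1
    ext s
    have h2 : ¬ (0 < s ∧ s ≤ t) := fun h' => absurd (h'.1.trans_le h'.2) (not_lt.2 h)
    by_cases h1 : t < s ∧ s ≤ 0 <;> simp [retardedWeight, h1, h2]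

end StrichartzSobolev

/-! ### Assembly of the three estimates. -/

open StrichartzSobolev in
theorem theorem3p3 (ψ : ℝ → ℝ) (hψ : IsBump ψ) :
    -- homogeneous estimate
    (∀ q r : ℝ≥0∞, HalfAdmissible q r →
      ∃ C : ℝ≥0, ∀ (κ : ℝ) (_ : 0 < κ) (k : ℤ) (f : 𝓢(Plane, ℂ)),
        mixedNorm q r (fun t => propagator κ t (lpProj ψ k f)) ≤
          C * strichartzFactor κ k (1 / q).toReal * eLpNorm (lpProj ψ k f) 2 volume) ∧
    -- dual estimate
    (∀ q r : ℝ≥0∞, HalfAdmissible q r →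
      ∃ C : ℝ≥0, ∀ q' r' : ℝ≥0∞, 1 / q + 1 / q' = 1 → 1 / r + 1 / r' = 1 →
        ∀ (κ : ℝ) (_ : 0 < κ) (k : ℤ) (F : 𝓢(ℝ × Plane, ℂ)),
        eLpNorm (fun x : Plane => ∫ s : ℝ, propagator κ (-s) (lpProjSpace ψ k F s) x) 2 volume ≤
          C * strichartzFactor κ k (1 / q).toReal * mixedNorm q' r' (lpProjSpace ψ k F)) ∧
    -- inhomogeneous (retarded) estimate
    (∀ q₁ r₁ q₂ r₂ : ℝ≥0∞, HalfAdmissible q₁ r₁ → HalfAdmissible q₂ r₂ →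
      ∃ C : ℝ≥0, ∀ q₂' r₂' : ℝ≥0∞, 1 / q₂ + 1 / q₂' = 1 → 1 / r₂ + 1 / r₂' = 1 →
        ∀ (κ : ℝ) (_ : 0 < κ) (k : ℤ) (F : 𝓢(ℝ × Plane, ℂ)),
        mixedNorm q₁ r₁ (fun t x =>
            ∫ s in (0 : ℝ)..t, propagator κ (t - s) (lpProjSpace ψ k F s) x) ≤
          C * strichartzFactor κ k ((1 / q₁).toReal + (1 / q₂).toReal) *
            mixedNorm q₂' r₂' (lpProjSpace ψ k F)) := by
  refine ⟨fun q r h => ?_, fun q r h => ?_, fun q₁ r₁ q₂ r₂ h₁ h₂ => ?_⟩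
  · refine ⟨12 ^ (4 * (1 / q).toReal), fun κ hκ k f => ?_⟩
    rw [← ofReal_rpow_admissible hκ k]
    have hD := dispersiveGroup hκ k
    simp_rw [hψ.propagator_lpProj]
    obtain ⟨g, hg, -⟩ := hψ.exists_schwartz_eq_lpProj k f
    rw [← hg]
    have hg1 : Integrable (g : Plane → ℂ) := g.integrable
    have hg2 : MemLp (g : Plane → ℂ) 2 volume := g.memLp 2
    have hle := eLpNorm_fourier_le hg1 hg2
    have hc : Continuous (𝓕 (g : Plane → ℂ)) := continuous_fourier_of_integrable hg1
    have hF2 : MemLp (𝓕 (g : Plane → ℂ)) 2 volume :=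
      ⟨hc.aestronglyMeasurable, hle.trans_lt hg2.2⟩
    refine (hD.mixedNorm_evol_le h hc.measurable (hF2.restrict _)).trans ?_
    exact mul_le_mul_right ((eLpNorm_restrict_le _ _ _ _).trans hle) _
  · refine ⟨12 ^ (4 * (1 / q).toReal), fun q' r' hq hr κ hκ k F => ?_⟩
    rw [← ofReal_rpow_admissible hκ k]
    have hD := dispersiveGroup hκ k
    have hG := hψ.forcing_lpProjSpace k F
    -- The dual operator is the superposition with weight 1, observed at time 0; Plancherel then
    -- reduces the claim to the profile.
    have e : ∀ x, ∫ s : ℝ, propagator κ (-s) (lpProjSpace ψ k F s) x =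
        evol (dispersion κ) (annulus (innerRadius k)) 0
          (profile (dispersion κ) (fun _ => 1) (lpProjSpace ψ k F)) x := fun x => by
      rw [← hD.integral_evol_eq_evol_profile hG measurable_const (fun _ => by simp)]
      simp_rw [hψ.propagator_lpProjSpace, zero_sub, one_mul]
    simp_rw [e]
    refine (eLpNorm_evol_le hD.measurable_symbol hD.measurableSet hD.volume_ne_top 0
      (hD.memLp_profile hG measurable_const (fun _ => by simp) 2)).trans ?_
    exact hD.eLpNorm_profile_le hG measurable_const (fun _ => by simp) h hq hr
  · refine ⟨12 ^ (4 * ((1 / q₁).toReal + (1 / q₂).toReal)), fun q₂' r₂' hq hr κ hκ k F => ?_⟩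
    rw [← ofReal_rpow_admissible hκ k]
    have hD := dispersiveGroup hκ k
    have hG := hψ.forcing_lpProjSpace k F
    have e : ∀ t x, ∫ s in (0 : ℝ)..t, propagator κ (t - s) (lpProjSpace ψ k F s) x =
        evol (dispersion κ) (annulus (innerRadius k)) t
          (profile (dispersion κ) (retardedWeight t) (lpProjSpace ψ k F)) x := fun t x => by
      have hm : Measurable (retardedWeight t) :=
        measurable_retardedWeight.comp measurable_prodMk_left
      rw [← hD.integral_evol_eq_evol_profile hG hm (norm_retardedWeight_le t), integral_retardedWeight_mul]
      simp_rw [hψ.propagator_lpProjSpace]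
    simp_rw [e]
    refine (hD.mixedNorm_evol_profile_le hG measurable_retardedWeight norm_retardedWeight_le
      h₁ h₂ hq hr).trans (le_of_eq ?_)
    -- The powers of D for the two pairs multiply, so the exponents 1/q₁ and 1/q₂ add.
    rw [← mul_assoc, mul_add, ENNReal.rpow_add_of_nonneg _ _ (by positivity) (by positivity)]
    rfl
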